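/- **Theorem 1.3.** *Setting.* A MOY graph $\Gamma$ is a finite oriented trivalent graph without sinks or sources (multiple edges, loops, and circle components without vertices are allowed), embedded in the plane, with a total order on its vertices. The three flags (half-edges) at a vertex $v$ are $(v,l),(v,m),(v,r)$: $(v,m)$ is the one whose direction (incoming or outgoing) differs from that of the other two, and $(v,l)$, $(v,r)$ are the left and the right one seen along the orientation. A circle component is one edge with one half-edge. A coloring is a flow $\gamma:E(\Gamma)\to\mathbb N$. A cycle is a $2$-regular subgraph, possibly empty, all of whose components are consistently oriented; $\mathrm{rot}(C)$ is the number of counterclockwise minus the number of clockwise components of $C$. $\Gamma$ is *positive* if $\mathrm{rot}(C)>0$ for every nonempty cycle $C$. *Evaluations.* Let $N\ge1$ and $A_N=\{-\frac{N-1}2,-\frac{N-3}2,\dots,\frac{N-1}2\}$. A state assigns to each cycle $C$ a set $\sigma(C)\subset A_N$, with $\sigma(\emptyset)=\emptyset$ and $\sigma(C)\cap\sigma(C')=\emptyset$ whenever $C\ne C'$. Put $\sigma(e)=\bigcup_{C\ni e}\sigma(C)$ for an edge $e$ (and $\sigma(v,s)=\sigma(e)$ if $(v,s)$ is a flag of $e$),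 $|\sigma|(e)=|\sigma(e)|$, $\mathrm{rot}(\sigma)=\sum_C\mathrm{rot}(C)\sum_{j\in\sigma(C)}j$, and $$\langle\Gamma,\gamma\rangle_N(q)=\sum_{\sigma:\,|\sigma|=\gamma}q^{\mathrm{rot}(\sigma)}\prod_v q^{\frac14(R(v;\sigma)-L(v;\sigma))},$$ where $L(v;\sigma)$ (resp. $R(v;\sigma)$) is the number of pairs $(i,j)\in\sigma(v,l)\times\sigma(v,r)$ with $i>j$ (resp. $i<j$). *Series.* All series have coefficients in $\mathbb Z((q^{1/4}))[a^{\pm1/2}]$. The variables $z_h,Z_h$ ($h$ a half-edge) commute except for $z_{v,r}z_{v,l}=q^{-1/4}z_{v,l}z_{v,r}$ and $Z_{v,r}Z_{v,l}=q^{-1/4}Z_{v,l}Z_{v,r}$. They are totally ordered vertex by vertex, with $z_{v,l}<z_{v,m}<z_{v,r}<Z_{v,r}<Z_{v,m}<Z_{v,l}$ at a vertex $v$ (the central variables of the circle components come last). For $\gamma:E(\Gamma)\to\mathbb N$, $z^\gamma Z^\gamma$ is the product, in this order, of $z_h^{\gamma(e)}$ and $Z_h^{\gamma(e)}$ over all half-edges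 $h$, where $e$ is the edge of $h$; for a cycle $C$, $z^CZ^C$ is the case where $\gamma$ is the indicator function of $C$. The variables $x_C$ ($C$ a cycle) satisfy $x_\emptyset=1$ and $x_Cx_{C'}=q^{\langle C,C'\rangle}x_{C'}x_C$ with $$\langle C,C'\rangle=\tfrac12\big(\#\{v:(v,l)\in C,(v,r)\in C'\}-\#\{v:(v,r)\in C,(v,l)\in C'\}\big),$$ and $\mu$ is the monomial map $x_{C_1}\cdots x_{C_k}\mapsto (z^{C_1}Z^{C_1})\cdots(z^{C_k}Z^{C_k})$, extended to formal power series. Let $$P_\Gamma(q,a,x)=\sum_C(a^{-1/2}q^{1/2})^{\mathrm{rot}(C)}x_C,\qquad (P_\Gamma(q,a,x),q)_\infty=\prod_{k=0}^{\infty}P_\Gamma\big(q,a,(q^{k\,\mathrm{rot}(C)}x_C)_C\big),$$ the product being taken in increasing order of $k$ from left to right, as a $q$-adic limit, coefficient by coefficient. In $P_\Gamma(q^{-1},a,x)$ and $P_\Gamma(q,a^{-1},x)$ only the coefficients $(a^{-1/2}q^{1/2})^{\mathrm{rot}(C)}$ are changed. Let $\mathcal R=\mathbb Z[[q^{1/2}]][a^{\pm1/2}]$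 and $\mathcal R_-=\mathbb Z[[q^{1/2}]][a^{-1/2}]$. For a ring $S$ of coefficients, $S\langle\langle y\rangle\rangle$ denotes the set of formal series $\sum_w c_w w$ over words $w$ in the variables $y$ with all $c_w\in S$. *Claim.* Assume that $\Gamma$ is positive. Then for every coloring $\gamma$ there is a unique $\langle\Gamma,\gamma\rangle(q,a)\in\mathbb Z((q^{1/4}))[a^{\pm1/2}]$ that is a rational function of $q^{1/2},a^{1/2}$ (that is, $d\,\langle\Gamma,\gamma\rangle(q,a)=n$ for some polynomials $n,d\in\mathbb Z[q^{1/2},a^{1/2}]$ with $d\neq0$) and satisfies $\langle\Gamma,\gamma\rangle(q,q^N)=\langle\Gamma,\gamma\rangle_N(q)$ for all integers $N\ge1$. The generating series $F_\Gamma(q,a)=\sum_\gamma\langle\Gamma,\gamma\rangle(q,a)\,z^\gamma Z^\gamma$ lies in $\mathcal R\langle\langle z,Z\rangle\rangle$. The infinite products $(P_\Gamma(q,a,x),q)_\infty$ and $(P_\Gamma(q,a^{-1},x),q)_\infty$ converge, $(P_\Gamma(q,a,x),q)_\infty\in\mathcal R_-\langle\langle x\rangle\rangle$, $\mu\big((P_\Gamma(q,a,x),q)_\infty\big)\in\mathcal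 R\langle\langle z,Z\rangle\rangle$, and $$F_\Gamma(q,a)\;\mu\big((P_\Gamma(q,a^{-1},x),q)_\infty\big)=\mu\big((P_\Gamma(q,a,x),q)_\infty\big),$$ $$F_\Gamma(q,q^2a)=\mu\big(P_\Gamma(q^{-1},a,x)\big)\,F_\Gamma(q,a)\,\mu\big(P_\Gamma(q,a^{-1},x)\big).$$ -/

import Mathlib

noncomputable section

/-! ### Coefficients

All coefficient rings sit inside `ℤ((q^{1/4}))[a^{1/2}, a^{-1/2}]`: the variable of the Laurent series
is `q^{1/4}`, and `LaurentPolynomial.T 1` is `a^{1/2}`. -/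

/-- The ring `ℤ((q^{1/4}))`. -/
abbrev QLaurent : Type := LaurentSeries ℤ

/-- The ring `ℤ((q^{1/4}))[a^{1/2}, a^{-1/2}]`. -/
abbrev Coeff : Type := LaurentPolynomial QLaurent

/-- `q^{1/4}` as a unit of `ℤ((q^{1/4}))`. -/
def qQuarter : QLaurentˣ where
  val := HahnSeries.single 1 1
  inv := HahnSeries.single (-1) 1
  val_inv := by simp
  inv_val := by simp

/-- `q^{1/4}` in the full coefficient ring. -/
def qQuarterC : Coeffˣ := Units.map (LaurentPolynomial.C (R := QLaurent)).toMonoidHom qQuarter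

/-- `q^{1/2}`. -/
def qHalf : Coeffˣ := qQuarterC ^ 2

/-- `a^{1/2}`. -/
def aHalf : Coeffˣ where
  val := LaurentPolynomial.T 1
  inv := LaurentPolynomial.T (-1)
  val_inv := by rw [← LaurentPolynomial.T_add]; simp
  inv_val := by rw [← LaurentPolynomial.T_add]; simp

/-- Specialization `a = q^N`, that is, `a^{1/2} ↦ q^{N/2}`. -/
def specA (N : ℕ) : Coeff →+* QLaurent :=
  LaurentPolynomial.eval₂ (RingHom.id QLaurent) (qQuarter ^ (2 * N))

/-- The substitution `a ↦ q^2 a`, that is, `a^{1/2} ↦ q a^{1/2}`. -/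
def shiftA : Coeff →+* Coeff :=
  LaurentPolynomial.eval₂ LaurentPolynomial.C (qQuarterC ^ 4 * aHalf)

/-- The coefficient of `a^{n/2} q^{e/4}`. -/
def Coeff.coeffAt (c : Coeff) (n e : ℤ) : ℤ := (AddMonoidAlgebra.coeff c n).coeff e

/-- The ring `𝓡 = ℤ[[q^{1/2}]][a^{1/2}, a^{-1/2}]`: only non-negative powers of `q^{1/2}` occur. -/
def ringR : Set Coeff := {c | ∀ n e : ℤ, c.coeffAt n e ≠ 0 → 0 ≤ e ∧ Even e}

/-- The ring `𝓡₋ = ℤ[[q^{1/2}]][a^{-1/2}]`. -/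
def ringRMinus : Set Coeff := {c | c ∈ ringR ∧ ∀ n e : ℤ, c.coeffAt n e ≠ 0 → n ≤ 0}

/-! ### Formal power series in `q`-commuting variables -/

/-- Formal power series in variables `X i` (`i : ι`, a finite totally ordered set) subject to
`X i * X j = q^{w i j / 4} X j * X i`, with coefficients in `Coeff`. A series is given by its
coefficients at the standard monomials `∏ (X i)^(m i)`, the factors being in increasing order. -/
def QSeries {ι : Type} (_w : ι → ι → ℤ) : Type := (ι →₀ ℕ) → Coeff

namespace QSeries

variable {ι : Type} {w : ι → ι → ℤ}

instance : AddCommGroup (QSeries w) := inferInstanceAs (AddCommGroup ((ι →₀ ℕ) → Coeff))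

instance : Module Coeff (QSeries w) := inferInstanceAs (Module Coeff ((ι →₀ ℕ) → Coeff))

/-- The coefficient of a standard monomial. -/
def coeff (f : QSeries w) (m : ι →₀ ℕ) : Coeff := f m

/-- The standard (increasingly ordered) monomial with exponents `m`. -/
def mono (m : ι →₀ ℕ) : QSeries w := fun n => by
  classical
  exact if n = m then 1 else 0

/-- The variable `X i`. -/
def X (i : ι) : QSeries w := mono (Finsupp.single i 1)

instance : One (QSeries w) := ⟨mono 0⟩

/-- Formal, possibly infinite, linear combination `∑ c_s g_s`, coefficient by coefficient. It is only
applied to families in which every monomial occurs in finitely many terms. -/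
def formalSum {σ : Type} (c : σ → Coeff) (g : σ → QSeries w) : QSeries w :=
  fun m => ∑ᶠ s, c s * (g s).coeff m

variable [Fintype ι] [LinearOrder ι]

/-- Reordering the product of the standard monomials with exponents `m` and `n` gives
`q^{reorder w m n / 4}` times the standard monomial with exponents `m + n`: each `X i` of the first
factor passes each smaller `X j` of the second one. -/
def reorder (w : ι → ι → ℤ) (m n : ι →₀ ℕ) : ℤ :=
  ∑ i, ∑ j, if j < i then w i j * (m i : ℤ) * (n j : ℤ) else 0

instance : Mul (QSeries w) where
  mul f g := fun m => ∑ p ∈ Finset.HasAntidiagonal.antidiagonal m,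
    ((qQuarterC ^ reorder w p.1 p.2 : Coeffˣ) : Coeff) * (f.coeff p.1 * g.coeff p.2)

/-- The product of the variables of a word, in the order in which they are written. -/
def word (l : List ι) : QSeries w := (l.map X).prod

/-- `f` belongs to `S⟨⟨X⟩⟩`: it is a formal series `∑ c_l l` over words `l` in the variables, with
all coefficients `c_l` in `S`. -/
def HasCoeffsIn (S : Set Coeff) (f : QSeries w) : Prop :=
  ∃ c : List ι → Coeff, (∀ l, c l ∈ S) ∧ f = formalSum c word

/-- `u k → f` coefficientwise in the `q`-adic topology: for each monomial, each power of `a^{1/2}` and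
each bound `B`, the coefficients of all `q^{e/4}`, `e ≤ B`, are eventually those of `f`. -/
def HasLimit (u : ℕ → QSeries w) (f : QSeries w) : Prop :=
  ∀ (m : ι →₀ ℕ) (n B : ℤ), ∃ K : ℕ, ∀ k ≥ K, ∀ e ≤ B,
    ((u k).coeff m).coeffAt n e = (f.coeff m).coeffAt n e

/-- Apply a ring homomorphism to all coefficients. -/
def mapCoeff (φ : Coeff →+* Coeff) (f : QSeries w) : QSeries w := fun m => φ (f.coeff m)

end QSeries

/-! ### MOY graphs -/

/-- The three flags at a vertex: left, middle, right. -/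
inductive Slot | l | m | r
deriving DecidableEq

instance : Fintype Slot := ⟨{.l, .m, .r}, fun s => by cases s <;> simp⟩

/-- The two ends of an oriented edge: its origin and its target. -/
inductive EdgeEnd | tail | head
deriving DecidableEq

instance : Fintype EdgeEnd := ⟨{.tail, .head}, fun s => by cases s <;> simp⟩

/-- A MOY graph: a finite oriented trivalent graph without sinks or sources, possibly with multiple
edges, loops and circle components without vertices, drawn in the plane `ℂ`.
The vertices are totally ordered (they form `Fin nV`). The edges with end points form `Fin nE`, the
circle components `Fin nO`. -/
structure MOYGraph where
  nV : ℕ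
  nE : ℕ
  nO : ℕ
  /-- Each end of an edge is one of the three flags of a vertex, each flag being used once. -/
  glue : Fin nE × EdgeEnd ≃ Fin nV × Slot
  /-- The left and the right flag have the same direction, -/
  dir_lr : ∀ v, (glue.symm (v, .l)).2 = (glue.symm (v, .r)).2
  /-- and the middle flag has the other one (so there are no sinks and no sources). -/
  dir_lm : ∀ v, (glue.symm (v, .l)).2 ≠ (glue.symm (v, .m)).2
  /-- The position of each vertex, and of a base point on each circle. -/
  pt : Fin nV ⊕ Fin nO → ℂ
  /-- Each edge or circle is drawn as a curve with parameter in `[0, 1]`. -/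
  curve : Fin nE ⊕ Fin nO → ℝ → ℂ
  curve_cont : ∀ e, ContinuousOn (curve e) (Set.Icc 0 1)
  curve_tail : ∀ e, curve (.inl e) 0 = pt (.inl (glue (e, .tail)).1)
  curve_head : ∀ e, curve (.inl e) 1 = pt (.inl (glue (e, .head)).1)
  circle_zero : ∀ o, curve (.inr o) 0 = pt (.inr o)
  circle_one : ∀ o, curve (.inr o) 1 = pt (.inr o)
  /-- The drawing is an embedding: different points `pt` are different, -/
  pt_inj : Function.Injective pt
  /-- and interior points of curves are simple. -/
  curve_inj : ∀ e e' : Fin nE ⊕ Fin nO, ∀ t ∈ Set.Ioo (0 : ℝ) 1, ∀ t' ∈ Set.Icc (0 : ℝ) 1,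
    curve e t = curve e' t' → e = e' ∧ t = t'
  /-- The tangent vector with which the curve of a flag leaves the vertex. -/
  tangent : Fin nV × Slot → ℂ
  tangent_ne : ∀ f, tangent f ≠ 0
  tangent_tail : ∀ e, HasDerivWithinAt (curve (.inl e)) (tangent (glue (e, .tail))) (Set.Icc 0 1) 0
  tangent_head : ∀ e,
    HasDerivWithinAt (curve (.inl e)) (-tangent (glue (e, .head))) (Set.Icc 0 1) 1
  /-- If the middle edge is incoming, the flags are in the counterclockwise order middle, right, left
  (the left edge is on the left when one looks along the orientation), -/
  order_split : ∀ v, (glue.symm (v, .m)).2 = .head →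
    sbtw ((tangent (v, .m)).arg : Real.Angle) ((tangent (v, .r)).arg : Real.Angle)
      ((tangent (v, .l)).arg : Real.Angle)
  /-- and if it is outgoing they are in the counterclockwise order middle, left, right. -/
  order_merge : ∀ v, (glue.symm (v, .m)).2 = .tail →
    sbtw ((tangent (v, .m)).arg : Real.Angle) ((tangent (v, .l)).arg : Real.Angle)
      ((tangent (v, .r)).arg : Real.Angle)

namespace MOYGraph

variable (Γ : MOYGraph)

/-- The edges, including the circle components. -/
abbrev Edge : Type := Fin Γ.nE ⊕ Fin Γ.nO

/-- The half-edges: the flags at the vertices, and one for each circle component. -/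
abbrev HalfEdge : Type := (Fin Γ.nV × Slot) ⊕ Fin Γ.nO

/-- The edge to which a flag belongs. -/
def flagEdge (v : Fin Γ.nV) (s : Slot) : Γ.Edge := .inl (Γ.glue.symm (v, s)).1

/-- The edge to which a half-edge belongs. -/
def edgeOf : Γ.HalfEdge → Γ.Edge := Sum.elim (fun f => Γ.flagEdge f.1 f.2) Sum.inr

/-- The flags of incoming edges at `v`. -/
def inSlots (v : Fin Γ.nV) : Finset Slot :=
  Finset.univ.filter fun s => (Γ.glue.symm (v, s)).2 = .head

/-- The flags of outgoing edges at `v`. -/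
def outSlots (v : Fin Γ.nV) : Finset Slot :=
  Finset.univ.filter fun s => (Γ.glue.symm (v, s)).2 = .tail

/-- Colorings: flows with values in the natural numbers. -/
def Flow : Type :=
  {γ : Γ.Edge → ℕ // ∀ v, ∑ s ∈ Γ.inSlots v, γ (Γ.flagEdge v s) =
    ∑ s ∈ Γ.outSlots v, γ (Γ.flagEdge v s)}

/-- A set of edges is a cycle if at each vertex it has either no flag at all, or exactly two flags,
one incoming and one outgoing. -/
def IsCycle (C : Finset Γ.Edge) : Prop :=
  ∀ v, (((Γ.inSlots v).filter fun s => Γ.flagEdge v s ∈ C).card = 0 ∧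
      ((Γ.outSlots v).filter fun s => Γ.flagEdge v s ∈ C).card = 0) ∨
    (((Γ.inSlots v).filter fun s => Γ.flagEdge v s ∈ C).card = 1 ∧
      ((Γ.outSlots v).filter fun s => Γ.flagEdge v s ∈ C).card = 1)

/-- The set of cycles of the graph, including the empty one. -/
abbrev Cycle : Type := {C : Finset Γ.Edge // Γ.IsCycle C}

instance : Fintype Γ.Cycle := Fintype.ofFinite _

/-- The empty cycle. -/
def emptyCycle : Γ.Cycle := ⟨∅, fun _ => Or.inl (by simp)⟩

/-- Two edges share a vertex. -/
def Adjacent (e e' : Γ.Edge) : Prop := ∃ v s s', Γ.flagEdge v s = e ∧ Γ.flagEdge v s' = e'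

/-- The connected components of a cycle, as sets of edges. -/
def components (C : Finset Γ.Edge) : Finset (Finset Γ.Edge) := by
  classical
  exact C.image fun e =>
    C.filter (Relation.EqvGen (fun x y => x ∈ C ∧ y ∈ C ∧ Γ.Adjacent x y) e)

/-- A connected cycle is oriented counterclockwise if its winding number about some point `p` not on
it is `1`. Here `θ e` is a continuous argument of `curve e - p`. -/
def IsCCW (K : Finset Γ.Edge) : Prop :=
  ∃ (p : ℂ) (θ : Γ.Edge → ℝ → ℝ),
    (∀ e ∈ K, ContinuousOn (θ e) (Set.Icc 0 1) ∧ ∀ t ∈ Set.Icc (0 : ℝ) 1, Γ.curve e t ≠ p ∧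
      Γ.curve e t - p = (‖Γ.curve e t - p‖ : ℂ) * Complex.exp ((θ e t : ℂ) * Complex.I)) ∧
    ∑ e ∈ K, (θ e 1 - θ e 0) = 2 * Real.pi

/-- The rotation number: each connected component counts `1` if it is oriented counterclockwise, and
`-1` if it is oriented clockwise. -/
def rot (C : Γ.Cycle) : ℤ := by
  classical
  exact ∑ K ∈ Γ.components C.1, if Γ.IsCCW K then 1 else -1

/-- Every nonempty cycle has positive rotation number. -/
def Positive : Prop := ∀ C : Γ.Cycle, C.1.Nonempty → 0 < Γ.rot C

/-! ### The MOY evaluation -/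

/-- Twice the elements of `A_N = {-(N-1)/2, -(N-3)/2, …, (N-1)/2}`. -/
def labels (N : ℕ) : Finset ℤ := (Finset.range N).image fun k : ℕ => 2 * (k : ℤ) - ((N : ℤ) - 1)

/-- States: families of pairwise disjoint sets of labels indexed by the cycles, the set of the empty
cycle being empty. -/
def states (N : ℕ) : Finset (Γ.Cycle → Finset ℤ) := by
  classical
  exact (Fintype.piFinset fun _ : Γ.Cycle => (labels N).powerset).filter fun σ =>
    σ Γ.emptyCycle = ∅ ∧ ∀ C C', C ≠ C' → Disjoint (σ C) (σ C')

variable {Γ} in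
/-- The set of labels of an edge: the union of the `σ C` over the cycles `C` containing it. -/
def edgeLabels (σ : Γ.Cycle → Finset ℤ) (e : Γ.Edge) : Finset ℤ :=
  (Finset.univ.filter fun C : Γ.Cycle => e ∈ C.1).biUnion σ

variable {Γ} in
/-- Twice the rotation number of a state. -/
def twiceRot (σ : Γ.Cycle → Finset ℤ) : ℤ := ∑ C, Γ.rot C * ∑ x ∈ σ C, x

variable {Γ} in
/-- Number of pairs of labels at the left and the right flag of `v`, the left one being larger. -/
def numL (v : Fin Γ.nV) (σ : Γ.Cycle → Finset ℤ) : ℕ :=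
  ((edgeLabels σ (Γ.flagEdge v .l) ×ˢ edgeLabels σ (Γ.flagEdge v .r)).filter
    fun p => p.1 > p.2).card

variable {Γ} in
/-- Number of pairs of labels at the left and the right flag of `v`, the left one being smaller. -/
def numR (v : Fin Γ.nV) (σ : Γ.Cycle → Finset ℤ) : ℕ :=
  ((edgeLabels σ (Γ.flagEdge v .l) ×ˢ edgeLabels σ (Γ.flagEdge v .r)).filter
    fun p => p.1 < p.2).card

/-- The vertex weight `q^{(R - L)/4}`. -/
def wt (v : Fin Γ.nV) (σ : Γ.Cycle → Finset ℤ) : QLaurentˣ :=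
  qQuarter ^ ((numR v σ : ℤ) - (numL v σ : ℤ))

/-- The evaluation `⟨Γ, γ⟩_N(q)`; note `q^{rot σ} = (q^{1/4})^{2 * twiceRot σ}`. -/
def evalN (γ : Γ.Flow) (N : ℕ) : QLaurent := by
  classical
  exact ∑ σ ∈ (Γ.states N).filter (fun σ => ∀ e, (edgeLabels σ e).card = γ.1 e),
    ((qQuarter ^ (2 * twiceRot σ) * ∏ v, Γ.wt v σ : QLaurentˣ) : QLaurent)

/-- `h` is the evaluation `⟨Γ, γ⟩(q, a)`: it is a rational function of `q^{1/2}` and `a^{1/2}` whose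
value at `a = q^N` is `⟨Γ, γ⟩_N(q)` for every positive integer `N`. -/
def IsHomfly (γ : Γ.Flow) (h : Coeff) : Prop :=
  (∃ num den : MvPolynomial (Fin 2) ℤ, den ≠ 0 ∧
    MvPolynomial.aeval ![(qHalf : Coeff), (aHalf : Coeff)] den * h =
      MvPolynomial.aeval ![(qHalf : Coeff), (aHalf : Coeff)] num) ∧
  ∀ N : ℕ, 1 ≤ N → specA N h = Γ.evalN γ N

/-- The evaluation `⟨Γ, γ⟩(q, a)`. -/
def homfly (γ : Γ.Flow) : Coeff := Classical.epsilon (Γ.IsHomfly γ)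

/-! ### The variables `z`, `Z` and `x` -/

/-- The variables `z_h` and `Z_h`, for each half-edge `h`. -/
inductive HVar
  | z (h : Γ.HalfEdge)
  | Z (h : Γ.HalfEdge)

variable {Γ} in
/-- The place of a variable in the total order: vertex by vertex, and at each vertex
`z_l < z_m < z_r < Z_r < Z_m < Z_l`; the (central) variables of the circles come last. -/
def HVar.place : Γ.HVar → ℕ
  | .z (.inl (v, .l)) => 6 * v
  | .z (.inl (v, .m)) => 6 * v + 1
  | .z (.inl (v, .r)) => 6 * v + 2
  | .Z (.inl (v, .r)) => 6 * v + 3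
  | .Z (.inl (v, .m)) => 6 * v + 4
  | .Z (.inl (v, .l)) => 6 * v + 5
  | .z (.inr o) => 6 * Γ.nV + 2 * o
  | .Z (.inr o) => 6 * Γ.nV + 2 * o + 1

variable {Γ} in
theorem HVar.place_injective : Function.Injective (HVar.place (Γ := Γ)) := by
  rintro ((⟨v, s⟩ | o) | (⟨v, s⟩ | o)) ((⟨v', s'⟩ | o') | (⟨v', s'⟩ | o')) h
  all_goals first
    | cases s <;> cases s' <;> simp only [HVar.place] at h <;> first
      | (exfalso; omega)
      | (obtain rfl : v = v' := Fin.ext (by omega)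
         rfl)
    | cases s <;> simp only [HVar.place] at h <;> exfalso <;> omega
    | cases s' <;> simp only [HVar.place] at h <;> exfalso <;> omega
    | (simp only [HVar.place] at h
       first
        | (exfalso; omega)
        | (obtain rfl : o = o' := Fin.ext (by omega)
           rfl))

instance : LinearOrder Γ.HVar := LinearOrder.lift' HVar.place HVar.place_injective

instance : Fintype Γ.HVar :=
  Fintype.ofSurjective (Sum.elim HVar.z HVar.Z : Γ.HalfEdge ⊕ Γ.HalfEdge → Γ.HVar) (by
    rintro (h | h)
    exacts [⟨.inl h, rfl⟩, ⟨.inr h, rfl⟩])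

variable {Γ} in
/-- The commutation exponents: `z_{v,r} z_{v,l} = q^{-1/4} z_{v,l} z_{v,r}`,
`Z_{v,r} Z_{v,l} = q^{-1/4} Z_{v,l} Z_{v,r}`, and all other pairs commute. -/
def hComm : Γ.HVar → Γ.HVar → ℤ
  | .z (.inl (v, .r)), .z (.inl (v', .l)) => if v = v' then -1 else 0
  | .z (.inl (v, .l)), .z (.inl (v', .r)) => if v = v' then 1 else 0
  | .Z (.inl (v, .r)), .Z (.inl (v', .l)) => if v = v' then -1 else 0
  | .Z (.inl (v, .l)), .Z (.inl (v', .r)) => if v = v' then 1 else 0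
  | _, _ => 0

/-- Formal power series in the variables `z`, `Z`. -/
abbrev ZSeries : Type := QSeries (hComm (Γ := Γ))

/-- The monomial `z^γ Z^γ` in standard order, for `γ : E(Γ) → ℕ`; each half-edge `h` of `e` contributes
`z_h^{γ(e)}` and `Z_h^{γ(e)}`. -/
def zZ (γ : Γ.Edge → ℕ) : Γ.ZSeries :=
  QSeries.mono (Finsupp.equivFunOnFinite.symm fun
    | .z h => γ (Γ.edgeOf h)
    | .Z h => γ (Γ.edgeOf h))

/-- The generating series `F_Γ(q, a, z, Z) = ∑_γ ⟨Γ, γ⟩(q, a) z^γ Z^γ`. -/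
def genSeries : Γ.ZSeries := QSeries.formalSum Γ.homfly fun γ => Γ.zZ γ.1

variable {Γ} in
/-- Four times the intersection product `⟨C, C'⟩`. -/
def cycleComm (C C' : Γ.Cycle) : ℤ :=
  2 * (((Finset.univ.filter fun v : Fin Γ.nV =>
      Γ.flagEdge v .l ∈ C.1 ∧ Γ.flagEdge v .r ∈ C'.1).card : ℤ) -
    ((Finset.univ.filter fun v : Fin Γ.nV =>
      Γ.flagEdge v .r ∈ C.1 ∧ Γ.flagEdge v .l ∈ C'.1).card : ℤ))

/-- The nonempty cycles, which index the variables `x_C`; for the empty cycle `x_∅ = 1`. -/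
def NCycle : Type := {C : Γ.Cycle // C.1.Nonempty}

instance : Fintype Γ.NCycle := Fintype.ofFinite {C : Γ.Cycle // C.1.Nonempty}

/-- An auxiliary total order, only used to single out standard monomials in the variables `x_C`. -/
instance : LinearOrder Γ.NCycle :=
  LinearOrder.lift' (Fintype.equivFin Γ.NCycle) (Fintype.equivFin Γ.NCycle).injective

/-- Formal power series in the variables `x_C`, where `x_C x_C' = q^{⟨C, C'⟩} x_C' x_C`. -/
abbrev XSeries : Type := QSeries fun C C' : Γ.NCycle => cycleComm C.1 C'.1

/-- The element `x_C`. -/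
def x (C : Γ.Cycle) : Γ.XSeries := by
  classical
  exact if h : C.1.Nonempty then QSeries.X ⟨C, h⟩ else 1

/-- `μ(x_C) = z^C Z^C`. -/
def muX (C : Γ.Cycle) : Γ.ZSeries := Γ.zZ fun e => if e ∈ C.1 then 1 else 0

/-- The monomial map `μ`, extended to formal power series: a standard monomial `x_{C₁} ⋯ x_{C_k}` is
sent to `μ(x_{C₁}) ⋯ μ(x_{C_k})`. -/
def mu (f : Γ.XSeries) : Γ.ZSeries :=
  QSeries.formalSum f.coeff fun n =>
    (((Finsupp.toMultiset n).sort (· ≤ ·)).map fun C => Γ.muX C.1).prod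

/-- The cycle polynomial `P_Γ(q, a, y) = ∑_C (a^{-1/2} q^{1/2})^{rot C} y_C`; the arguments `Q` and `A`
stand for `q^{1/2}` and `a^{1/2}`. -/
def cyclePoly (Q A : Coeffˣ) (y : Γ.Cycle → Γ.XSeries) : Γ.XSeries :=
  ∑ C, (((A⁻¹ * Q) ^ Γ.rot C : Coeffˣ) : Coeff) • y C

/-- `(P_Γ(q, a, x), q)_n = ∏_{k=0}^{n-1} P_Γ(q, a, q^{k rot C} x_C)`, in increasing order of `k`. -/
def poch (Q A : Coeffˣ) (n : ℕ) : Γ.XSeries :=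
  ((List.range n).map fun k =>
    Γ.cyclePoly Q A fun C => (((Q ^ 2) ^ ((k : ℤ) * Γ.rot C) : Coeffˣ) : Coeff) • Γ.x C).prod

/-- `(P_Γ(q, a, x), q)_∞`, the limit of the finite products. -/
def pochInf (Q A : Coeffˣ) : Γ.XSeries := Classical.epsilon (QSeries.HasLimit (Γ.poch Q A))

end MOYGraph

end

/-!
The state sum `⟨Γ, γ⟩_N` is a sum over functions from the `N` labels to the cycles, and the vertex
weights are exactly the powers of `q` that arise when `μ(x_{C₁}) ⋯ μ(x_{C_N})` is brought into standard
order. So the generating series of the `⟨Γ, γ⟩_N` is the image under `μ` of the ordered product, over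
`j ∈ A_N` in increasing order, of the factors `∑_C q^{j rot C} x_C` (`coeff_prod_eq_evalN`).

All infinite products come from a single series `E = ∏_{k ≥ 0} ∑_C q^{k rot C} x_C` by rescaling the
variables, `x_C ↦ u^{rot C} x_C`: `(P_Γ(q, a^{±1}, x), q)_∞` is `E` scaled by `u = a^{∓1/2} q^{1/2}`.
`E` is the solution of a `q`-difference equation, `E(x) = P(x) E(q^{rot C} x_C)`. Positivity of `Γ` makes
the degree of every nonconstant monomial positive, so this equation determines the coefficients
recursively, with denominators `1 - q^k`, `k > 0` (`exists_qDifference`); this shows at once that they are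
rational, that they are integral as coefficients of words, and that they do not involve `a`. If `G` is
the inverse of `E`, the finite products are `E(x) G(q^{n rot C} x_C)` and so converge to `E`
(`hasLimit_scale_linProd`).

Put `Φ = E(a^{-1/2} q^{1/2} · x) G(a^{1/2} q^{1/2} · x)` (`quotSeries`). Then `F_Γ(q, a) = μ(Φ)`: at
`a = q^N` all factors cancel except for the first `N` of the numerator, which are those belonging to `A_N`
(`mapHom_mu_quotSeries`); hence the coefficients of `μ(Φ)` interpolate the `⟨Γ, γ⟩_N`, and an element of
`ℤ((q^{1/4}))[a^{±1/2}]` is determined by its values at `a = q^N`. The two identities for the generating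
series are then identities for `Φ`, to which the ring homomorphism `μ` is applied.

That no odd powers of `q^{1/4}` occur is a parity statement: two flows exchange left and right flags an
even number of times (`even_reorder_hExp`). The embedding of `Γ` in the plane is used only through the
numbers `rot C`.
-/

noncomputable section

/-! ### The ring of series in `q`-commuting variables -/

/-- The power `q^{k/4}` in the coefficient ring. -/
def qpow (k : ℤ) : Coeff := ((qQuarterC ^ k : Coeffˣ) : Coeff)

@[simp] theorem qpow_zero : qpow 0 = 1 := by simp [qpow]

theorem qpow_add (k l : ℤ) : qpow (k + l) = qpow k * qpow l := by simp [qpow, zpow_add]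

theorem map_zpow_of_map_eq {R S : Type*} [Semiring R] [Semiring S] {φ : R →+* S} {u : Rˣ} {v : Sˣ}
    (h : φ u = v) (k : ℤ) : φ ((u ^ k : Rˣ) : R) = ((v ^ k : Sˣ) : S) := by
  have : Units.map (φ : R →* S) u = v := Units.ext h
  rw [← this, ← map_zpow]
  rfl

namespace QSeries

open Finset.HasAntidiagonal (antidiagonal mem_antidiagonal)

variable {ι : Type} {w : ι → ι → ℤ}

@[ext] theorem ext {f g : QSeries w} (h : ∀ m, f.coeff m = g.coeff m) : f = g := funext h

@[simp] theorem coeff_add (f g : QSeries w) (m) : (f + g).coeff m = f.coeff m + g.coeff m := rfl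
@[simp] theorem coeff_zero (m) : (0 : QSeries w).coeff m = 0 := rfl
@[simp] theorem coeff_smul (c : Coeff) (f : QSeries w) (m) : (c • f).coeff m = c * f.coeff m := rfl

theorem coeff_mono (m n : ι →₀ ℕ) [Decidable (n = m)] :
    (mono m : QSeries w).coeff n = if n = m then 1 else 0 := by
  simp only [coeff, mono]; congr

@[simp] theorem coeff_mono_self (m : ι →₀ ℕ) : (mono m : QSeries w).coeff m = 1 := by
  classical simp [coeff_mono]

theorem coeff_mono_ne {m n : ι →₀ ℕ} (h : n ≠ m) : (mono m : QSeries w).coeff n = 0 := by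
  classical simp [coeff_mono, h]

theorem one_eq_mono : (1 : QSeries w) = mono 0 := rfl

@[simp] theorem coeff_one_zero : (1 : QSeries w).coeff 0 = 1 := by
  rw [one_eq_mono, coeff_mono_self]

theorem coeff_one_ne {m : ι →₀ ℕ} (h : m ≠ 0) : (1 : QSeries w).coeff m = 0 := by
  rw [one_eq_mono, coeff_mono_ne h]

theorem coeff_sum {σ : Type*} (s : Finset σ) (f : σ → QSeries w) (m) :
    (∑ i ∈ s, f i).coeff m = ∑ i ∈ s, (f i).coeff m := by
  classical
  induction s using Finset.induction_on with
  | empty => rfl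
  | insert a s ha ih => rw [Finset.sum_insert ha, Finset.sum_insert ha, coeff_add, ih]

/-- A series with given constant coefficient can be prescribed by a recursion that expresses each
coefficient by those of smaller monomials. -/
theorem exists_recursion [Finite ι] (r : (ι →₀ ℕ) → ((ι →₀ ℕ) → Coeff) → Coeff)
    (hr : ∀ m f g, (∀ n < m, f n = g n) → r m f = r m g) :
    ∃ f : QSeries w, ∀ m, f.coeff m = r m f.coeff := by
  classical
  have wf : WellFounded ((· < ·) : (ι →₀ ℕ) → (ι →₀ ℕ) → Prop) := wellFounded_lt
  refine ⟨wf.fix fun m F => r m fun n => if h : n < m then F n h else 0, fun m => ?_⟩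
  change wf.fix _ m = _
  rw [wf.fix_eq]
  refine hr _ _ _ fun n hn => ?_
  simp [hn, coeff]

theorem lt_of_mem_antidiagonal [DecidableEq ι] {m : ι →₀ ℕ} {p : (ι →₀ ℕ) × (ι →₀ ℕ)}
    (hp : p ∈ (antidiagonal m).filter (fun p => p.2 ≠ m)) : p.2 < m := by
  rw [Finset.mem_filter, mem_antidiagonal] at hp
  exact lt_of_le_of_ne (hp.1 ▸ le_add_self) hp.2

section Degree

variable [Fintype ι]

/-- The degree of a monomial for the grading in which the variable `X i` has degree `d i`. -/
def wdeg (d : ι → ℤ) (m : ι →₀ ℕ) : ℤ := ∑ i, d i * (m i : ℤ)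

theorem wdeg_add (d : ι → ℤ) (m n : ι →₀ ℕ) : wdeg d (m + n) = wdeg d m + wdeg d n := by
  simp [wdeg, mul_add, Finset.sum_add_distrib]

@[simp] theorem wdeg_zero (d : ι → ℤ) : wdeg d 0 = 0 := by simp [wdeg]

theorem wdeg_single (d : ι → ℤ) (i : ι) : wdeg d (Finsupp.single i 1) = d i := by
  rw [wdeg, Finset.sum_eq_single i]
  · simp
  · intro j _ hj; simp [hj.symm]
  · simp

theorem wdeg_nonneg {d : ι → ℤ} (hd : ∀ i, 0 < d i) (m : ι →₀ ℕ) : 0 ≤ wdeg d m :=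
  Finset.sum_nonneg fun i _ => mul_nonneg (hd i).le (by positivity)

theorem wdeg_pos {d : ι → ℤ} (hd : ∀ i, 0 < d i) {m : ι →₀ ℕ} (hm : m ≠ 0) : 0 < wdeg d m := by
  obtain ⟨i, hi⟩ := Finsupp.ne_iff.1 hm
  refine Finset.sum_pos' (fun i _ => mul_nonneg (hd i).le (by positivity)) ⟨i, by simp, ?_⟩
  exact mul_pos (hd i) (by exact_mod_cast Nat.pos_of_ne_zero hi)

end Degree

variable [Fintype ι] [LinearOrder ι]

theorem reorder_add_left (m m' n : ι →₀ ℕ) :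
    reorder w (m + m') n = reorder w m n + reorder w m' n := by
  simp only [reorder, ← Finset.sum_add_distrib]
  refine Finset.sum_congr rfl fun i _ => Finset.sum_congr rfl fun j _ => ?_
  split_ifs
  · simp only [Finsupp.add_apply]; push_cast; ring
  · simp

theorem reorder_add_right (m n n' : ι →₀ ℕ) :
    reorder w m (n + n') = reorder w m n + reorder w m n' := by
  simp only [reorder, ← Finset.sum_add_distrib]
  refine Finset.sum_congr rfl fun i _ => Finset.sum_congr rfl fun j _ => ?_
  split_ifs
  · simp only [Finsupp.add_apply]; push_cast; ring
  · simp

@[simp] theorem reorder_zero_left (n : ι →₀ ℕ) : reorder w 0 n = 0 := by simp [reorder]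

@[simp] theorem reorder_zero_right (n : ι →₀ ℕ) : reorder w n 0 = 0 := by simp [reorder]

theorem reorder_single (i j : ι) :
    reorder w (Finsupp.single i 1) (Finsupp.single j 1) = if j < i then w i j else 0 := by
  rw [reorder, Finset.sum_eq_single i, Finset.sum_eq_single j]
  · simp
  · intro j' _ hj'; simp [hj'.symm]
  · simp
  · intro i' _ hi'; simp [hi'.symm]
  · simp

theorem coeff_mul (f g : QSeries w) (m : ι →₀ ℕ) :
    (f * g).coeff m = ∑ p ∈ antidiagonal m,
      qpow (reorder w p.1 p.2) * (f.coeff p.1 * g.coeff p.2) := rfl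

theorem mono_mul_mono (m n : ι →₀ ℕ) :
    (mono m * mono n : QSeries w) = qpow (reorder w m n) • mono (m + n) := by
  classical
  ext k : 1
  rw [coeff_mul, coeff_smul, coeff_mono]
  split_ifs with h
  · rw [Finset.sum_eq_single (m, n)]
    · simp
    · rintro ⟨a, b⟩ _ hab
      by_cases ha : a = m
      · have hb : b ≠ n := fun hb => hab (by rw [ha, hb])
        simp [coeff_mono_ne hb]
      · simp [coeff_mono_ne ha]
    · intro hk; simp [h] at hk
  · rw [Finset.sum_eq_zero, mul_zero]
    rintro ⟨a, b⟩ hab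
    by_cases ha : a = m
    · have hb : b ≠ n := fun hb => h (by
        rw [mem_antidiagonal] at hab; rw [← hab, ha, hb])
      simp [coeff_mono_ne hb]
    · simp [coeff_mono_ne ha]

theorem mul_assoc_aux (f g h : QSeries w) : f * g * h = f * (g * h) := by
  ext m : 1
  simp only [coeff_mul, Finset.sum_mul, Finset.mul_sum, Finset.sum_sigma']
  apply Finset.sum_nbij' (fun ⟨⟨_i, j⟩, ⟨k, l⟩⟩ ↦ ⟨(k, l + j), (l, j)⟩)
    (fun ⟨⟨i, _j⟩, ⟨k, l⟩⟩ ↦ ⟨(i + k, l), (i, k)⟩)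
  · rintro ⟨⟨i, j⟩, ⟨k, l⟩⟩ h
    simp only [Finset.mem_sigma, mem_antidiagonal] at h ⊢
    simp [← h.1, ← h.2, add_assoc]
  · rintro ⟨⟨i, j⟩, ⟨k, l⟩⟩ h
    simp only [Finset.mem_sigma, mem_antidiagonal] at h ⊢
    simp [← h.1, ← h.2, add_assoc]
  · rintro ⟨⟨i, j⟩, ⟨k, l⟩⟩ h
    simp only [Finset.mem_sigma, mem_antidiagonal] at h ⊢
    simp [← h.2]
  · rintro ⟨⟨i, j⟩, ⟨k, l⟩⟩ h
    simp only [Finset.mem_sigma, mem_antidiagonal] at h ⊢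
    simp [← h.2]
  · rintro ⟨⟨i, j⟩, ⟨k, l⟩⟩ h
    simp only [Finset.mem_sigma, mem_antidiagonal] at h ⊢
    obtain ⟨-, h2⟩ := h
    have e : qpow (reorder w i j) * qpow (reorder w k l) =
        qpow (reorder w k (l + j)) * qpow (reorder w l j) := by
      rw [← qpow_add, ← qpow_add, ← h2, reorder_add_left, reorder_add_right]
      congr 1; ring
    linear_combination (f.coeff k * g.coeff l * h.coeff j) * e

instance : Ring (QSeries w) where
  mul_assoc := mul_assoc_aux
  one_mul f := by
    ext m : 1
    rw [coeff_mul, Finset.sum_eq_single (0, m)]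
    · simp [one_eq_mono]
    · rintro ⟨a, b⟩ hab h
      have : a ≠ 0 := by
        rintro rfl
        rw [mem_antidiagonal] at hab
        exact h (by simp [← hab])
      simp [one_eq_mono, coeff_mono_ne this]
    · simp
  mul_one f := by
    ext m : 1
    rw [coeff_mul, Finset.sum_eq_single (m, 0)]
    · simp [one_eq_mono]
    · rintro ⟨a, b⟩ hab h
      have : b ≠ 0 := by
        rintro rfl
        rw [mem_antidiagonal] at hab
        exact h (by simp [← hab])
      simp [one_eq_mono, coeff_mono_ne this]
    · simp
  zero_mul f := by ext m : 1; simp [coeff_mul]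
  mul_zero f := by ext m : 1; simp [coeff_mul]
  left_distrib f g h := by ext m : 1; simp [coeff_mul, mul_add, Finset.sum_add_distrib]
  right_distrib f g h := by ext m : 1; simp [coeff_mul, add_mul, mul_add, Finset.sum_add_distrib]
  neg_add_cancel := neg_add_cancel
  zsmul := fun n f => n • f
  nsmul := fun n f => n • f
  nsmul_zero f := zero_nsmul f
  nsmul_succ n f := succ_nsmul f n
  zsmul_zero' f := zero_zsmul f
  zsmul_succ' n f := SubNegMonoid.zsmul_succ' n f
  zsmul_neg' n f := SubNegMonoid.zsmul_neg' n f
  sub_eq_add_neg := sub_eq_add_neg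

instance : Algebra Coeff (QSeries w) := Algebra.ofModule
  (fun c f g => by
    ext m : 1
    simp only [coeff_mul, coeff_smul, Finset.mul_sum]
    exact Finset.sum_congr rfl fun p _ => by ring)
  (fun c f g => by
    ext m : 1
    simp only [coeff_mul, coeff_smul, Finset.mul_sum]
    exact Finset.sum_congr rfl fun p _ => by ring)

/-- The terms of a coefficient of a product in which the second factor is not of full degree. -/
theorem coeff_mul_eq_add (f g : QSeries w) (m : ι →₀ ℕ) :
    (f * g).coeff m = f.coeff 0 * g.coeff m +
      ∑ p ∈ (antidiagonal m).filter (fun p => p.2 ≠ m),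
        qpow (reorder w p.1 p.2) * (f.coeff p.1 * g.coeff p.2) := by
  rw [coeff_mul, ← Finset.sum_filter_add_sum_filter_not _ (fun p => p.2 = m)]
  congr 1
  rw [Finset.sum_eq_single (0, m)]
  · simp
  · rintro ⟨a, b⟩ hab h
    simp only [Finset.mem_filter, mem_antidiagonal] at hab
    exact absurd (by obtain ⟨h1, h2⟩ := hab; subst h2; simpa using h1) h
  · simp

/-! ### Scaling the variables and changing the coefficients -/

/-- The automorphism `X i ↦ u^{d i} X i`. -/
def scale (d : ι → ℤ) (u : Coeffˣ) : QSeries w →+* QSeries w where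
  toFun f := fun m => ((u ^ wdeg d m : Coeffˣ) : Coeff) * f.coeff m
  map_one' := by
    ext m : 1
    change _ * (1 : QSeries w).coeff m = _
    by_cases h : m = 0
    · simp [h]
    · simp [coeff_one_ne h]
  map_mul' f g := by
    ext m : 1
    change _ * (f * g).coeff m = ∑ p ∈ antidiagonal m, qpow (reorder w p.1 p.2) *
      ((((u ^ wdeg d p.1 : Coeffˣ) : Coeff) * f.coeff p.1) *
        (((u ^ wdeg d p.2 : Coeffˣ) : Coeff) * g.coeff p.2))
    rw [coeff_mul, Finset.mul_sum]
    refine Finset.sum_congr rfl fun p hp => ?_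
    rw [← mem_antidiagonal.1 hp, wdeg_add, zpow_add]
    push_cast
    ring
  map_zero' := by
    ext m : 1
    change _ * (0 : QSeries w).coeff m = _
    simp
  map_add' f g := by
    ext m : 1
    change _ * (f + g).coeff m = _ * _ + _ * _
    simp [mul_add]

@[simp] theorem coeff_scale (d : ι → ℤ) (u : Coeffˣ) (f : QSeries w) (m) :
    (scale d u f).coeff m = ((u ^ wdeg d m : Coeffˣ) : Coeff) * f.coeff m := rfl

theorem scale_scale (d : ι → ℤ) (u v : Coeffˣ) (f : QSeries w) :
    scale d u (scale d v f) = scale d (u * v) f := by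
  ext m : 1
  have h : (u * v) ^ wdeg d m = u ^ wdeg d m * v ^ wdeg d m := mul_zpow u v _
  rw [coeff_scale, coeff_scale, coeff_scale, h, Units.val_mul, mul_assoc]

@[simp] theorem scale_one (d : ι → ℤ) (f : QSeries w) : scale d 1 f = f := by
  ext m : 1; simp

theorem map_qpow {φ : Coeff →+* Coeff} (hφ : φ qQuarterC = qQuarterC) (k : ℤ) :
    φ (qpow k) = qpow k :=
  map_zpow_of_map_eq hφ k

/-- A ring homomorphism of coefficients that fixes `q^{1/4}` acts on the series. -/
def mapHom (φ : Coeff →+* Coeff) (hφ : φ qQuarterC = qQuarterC) : QSeries w →+* QSeries w where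
  toFun := mapCoeff φ
  map_one' := by
    ext m : 1
    change φ ((1 : QSeries w).coeff m) = _
    by_cases h : m = 0
    · simp [h]
    · simp [coeff_one_ne h]
  map_mul' f g := by
    ext m : 1
    change φ ((f * g).coeff m) = ∑ p ∈ antidiagonal m,
      qpow (reorder w p.1 p.2) * (φ (f.coeff p.1) * φ (g.coeff p.2))
    simp [coeff_mul, map_qpow hφ]
  map_zero' := by
    ext m : 1
    change φ ((0 : QSeries w).coeff m) = _
    simp
  map_add' f g := by
    ext m : 1
    change φ ((f + g).coeff m) = φ _ + φ _
    simp

@[simp] theorem coeff_mapHom (φ : Coeff →+* Coeff) (hφ) (f : QSeries w) (m) :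
    (mapHom φ hφ f).coeff m = φ (f.coeff m) := rfl

theorem mapHom_scale (φ : Coeff →+* Coeff) (hφ) (d : ι → ℤ) (u v : Coeffˣ) (h : φ u = v)
    (f : QSeries w) : mapHom φ hφ (scale d u f) = scale d v (mapHom φ hφ f) := by
  ext m : 1
  simp only [coeff_mapHom, coeff_scale, map_mul]
  rw [map_zpow_of_map_eq h]

/-! ### Solving triangular equations -/

theorem exists_right_inv (f : QSeries w) (hf : f.coeff 0 = 1) :
    ∃ g : QSeries w, g.coeff 0 = 1 ∧ f * g = 1 := by
  obtain ⟨g, hg⟩ := exists_recursion (w := w) (fun m g => if m = 0 then 1 else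
    -∑ p ∈ (antidiagonal m).filter (fun p => p.2 ≠ m),
        qpow (reorder w p.1 p.2) * (f.coeff p.1 * g p.2)) (by
      intro m g h H
      split_ifs
      · rfl
      · rw [neg_inj]
        exact Finset.sum_congr rfl fun p hp => by rw [H _ (lt_of_mem_antidiagonal hp)])
  refine ⟨g, by simp [hg 0], ?_⟩
  ext m : 1
  rw [coeff_mul_eq_add, hf, one_mul, hg m]
  by_cases h : m = 0
  · subst h
    simp [Finset.filter_singleton]
  · simp [h, coeff_one_ne h]

/-- A series with constant coefficient `1` is invertible. -/
theorem exists_inv (f : QSeries w) (hf : f.coeff 0 = 1) :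
    ∃ g : QSeries w, g.coeff 0 = 1 ∧ f * g = 1 ∧ g * f = 1 := by
  obtain ⟨g, hg, hfg⟩ := exists_right_inv f hf
  obtain ⟨h, -, hgh⟩ := exists_right_inv g hg
  have : f = h := by rw [← mul_one f, ← hgh, ← mul_assoc, hfg, one_mul]
  exact ⟨g, hg, hfg, this ▸ hgh⟩

/-- A family of additive groups of coefficients, indexed by monomials, such that the series whose
coefficients lie in these groups form a ring. -/
structure IsMulFamily (w : ι → ι → ℤ) (B : (ι →₀ ℕ) → AddSubgroup Coeff) : Prop where
  one_mem : 1 ∈ B 0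
  mul_mem : ∀ {m n a b}, a ∈ B m → b ∈ B n → qpow (reorder w m n) * (a * b) ∈ B (m + n)

namespace IsMulFamily

variable {B : (ι →₀ ℕ) → AddSubgroup Coeff} (hB : IsMulFamily w B)
include hB

theorem coeff_one_mem (m) : (1 : QSeries w).coeff m ∈ B m := by
  by_cases h : m = 0
  · subst h; simpa using hB.one_mem
  · rw [coeff_one_ne h]; exact zero_mem _

theorem mul_mem_of_mem_antidiagonal {m : ι →₀ ℕ} {p : (ι →₀ ℕ) × (ι →₀ ℕ)}
    (hp : p ∈ antidiagonal m) {a b : Coeff} (ha : a ∈ B p.1) (hb : b ∈ B p.2) :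
    qpow (reorder w p.1 p.2) * (a * b) ∈ B m := by
  rw [← mem_antidiagonal.1 hp]
  exact hB.mul_mem ha hb

theorem coeff_mul_mem {f g : QSeries w} (hf : ∀ m, f.coeff m ∈ B m) (hg : ∀ m, g.coeff m ∈ B m)
    (m) : (f * g).coeff m ∈ B m :=
  sum_mem fun _ hp => hB.mul_mem_of_mem_antidiagonal hp (hf _) (hg _)

theorem coeff_inv_mem {f g : QSeries w} (h0 : f.coeff 0 = 1) (hf : ∀ m, f.coeff m ∈ B m)
    (hfg : f * g = 1) (m) : g.coeff m ∈ B m := by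
  induction m using WellFoundedLT.induction with
  | ind m ih =>
    have h := congrArg (fun s => s.coeff m) hfg
    simp only [coeff_mul_eq_add, h0, one_mul] at h
    rw [eq_sub_of_add_eq h]
    refine sub_mem (hB.coeff_one_mem m) (sum_mem fun p hp => ?_)
    exact hB.mul_mem_of_mem_antidiagonal (Finset.mem_filter.1 hp).1 (hf _)
      (ih _ (lt_of_mem_antidiagonal hp))

end IsMulFamily

end QSeries

namespace QSeries

open Finset.HasAntidiagonal (antidiagonal mem_antidiagonal)

/-! ### Products of monomials, and series with word coefficients in a subring -/

/-- The sum of `b i j` over all pairs of entries `i`, `j` of a list, `i` standing before `j`. -/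
def pairSum {ι : Type} (b : ι → ι → ℤ) : List ι → ℤ
  | [] => 0
  | a :: l => (l.map (b a)).sum + pairSum b l

variable {ι : Type} {w : ι → ι → ℤ}

/-- The exponents of the variables in a word. -/
def content (l : List ι) : ι →₀ ℕ := (l.map fun i => Finsupp.single i 1).sum

@[simp] theorem content_nil : content ([] : List ι) = 0 := rfl

@[simp] theorem content_cons (a : ι) (l : List ι) :
    content (a :: l) = Finsupp.single a 1 + content l := by simp [content]

theorem content_apply [DecidableEq ι] (l : List ι) (i : ι) : content l i = l.count i := by
  induction l with
  | nil => simp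
  | cons a l ih =>
    rw [content_cons, Finsupp.add_apply, ih, List.count_cons, Finsupp.single_apply, add_comm]
    simp

theorem content_sort [LinearOrder ι] (m : ι →₀ ℕ) :
    content ((Finsupp.toMultiset m).sort (· ≤ ·)) = m := by
  ext i
  rw [content_apply, ← Multiset.coe_count, Multiset.sort_eq, Finsupp.count_toMultiset]

theorem finite_content_eq [Finite ι] (m : ι →₀ ℕ) : {l : List ι | content l = m}.Finite := by
  refine (List.finite_length_eq ι m.degree).subset ?_
  rintro l rfl
  change l.length = _
  induction l with
  | nil => simp
  | cons a l ih => simp [ih, add_comm]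

variable [Fintype ι] [LinearOrder ι]

theorem reorder_sum_right {σ : Type} (m : ι →₀ ℕ) (y : σ → ι →₀ ℕ) (l : List σ) :
    reorder w m (l.map y).sum = (l.map fun i => reorder w m (y i)).sum := by
  induction l with
  | nil => simp
  | cons a l ih => simp [reorder_add_right, ih]

theorem prod_map_mono {σ : Type} (y : σ → ι →₀ ℕ) (l : List σ) :
    (l.map fun i => (mono (y i) : QSeries w)).prod =
      qpow (pairSum (fun i j => reorder w (y i) (y j)) l) • mono (l.map y).sum := by
  induction l with
  | nil => simp [pairSum, one_eq_mono]
  | cons a l ih =>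
    rw [List.map_cons, List.prod_cons, ih, mul_smul_comm, mono_mul_mono, smul_smul, ← qpow_add,
      List.map_cons, List.sum_cons, pairSum, reorder_sum_right, add_comm]

/-- A word is a power of `q^{1/4}` times the standard monomial with the same exponents. -/
theorem exists_word_eq (l : List ι) : ∃ k, (word l : QSeries w) = qpow k • mono (content l) :=
  ⟨_, prod_map_mono _ l⟩

theorem word_eq_coeff_smul (l : List ι) :
    (word l : QSeries w) = (word l : QSeries w).coeff (content l) • mono (content l) := by
  obtain ⟨k, hk⟩ := exists_word_eq (w := w) l
  rw [hk]; simp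

theorem coeff_word_ne {l : List ι} {m : ι →₀ ℕ} (h : content l ≠ m) :
    (word l : QSeries w).coeff m = 0 := by
  rw [word_eq_coeff_smul, coeff_smul, coeff_mono_ne h.symm, mul_zero]

/-- A word with weakly increasing letters is a standard monomial. -/
theorem word_eq_mono_of_sorted {l : List ι} (hl : l.Pairwise (· ≤ ·)) :
    (word l : QSeries w) = mono (content l) := by
  have h0 : pairSum (fun i j => reorder w (Finsupp.single i 1) (Finsupp.single j 1)) l = 0 := by
    induction l with
    | nil => rfl
    | cons a l ih =>
      rw [List.pairwise_cons] at hl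
      rw [pairSum, ih hl.2, add_zero]
      refine List.sum_eq_zero fun t ht => ?_
      obtain ⟨j, hj, rfl⟩ := List.mem_map.1 ht
      rw [reorder_single, if_neg (hl.1 j hj).not_gt]
  refine (prod_map_mono _ l).trans ?_
  rw [h0, qpow_zero, one_smul]
  rfl

theorem mono_eq_word (m : ι →₀ ℕ) :
    (mono m : QSeries w) = word ((Finsupp.toMultiset m).sort (· ≤ ·)) := by
  rw [word_eq_mono_of_sorted (Multiset.pairwise_sort _ _), content_sort]

theorem word_append (l l' : List ι) : (word (l ++ l') : QSeries w) = word l * word l' := by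
  simp [word]

/-- The possible coefficients, at the standard monomial with exponents `m`, of a series whose
coefficients at words lie in `S`. -/
def wordSpan (w : ι → ι → ℤ) (S : Subring Coeff) (m : ι →₀ ℕ) : AddSubgroup Coeff :=
  AddSubgroup.closure {t | ∃ s ∈ S, ∃ l, t = s * (word l : QSeries w).coeff m}

variable {S : Subring Coeff}

theorem mul_coeff_word_mem {s : Coeff} (hs : s ∈ S) (l : List ι) (m : ι →₀ ℕ) :
    s * (word l : QSeries w).coeff m ∈ wordSpan w S m :=
  AddSubgroup.subset_closure ⟨s, hs, l, rfl⟩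

theorem coeff_word_mem (l : List ι) (m : ι →₀ ℕ) :
    (word l : QSeries w).coeff m ∈ wordSpan w S m := by
  simpa using mul_coeff_word_mem (w := w) S.one_mem l m

theorem coeff_mono_mem (n m : ι →₀ ℕ) : (mono n : QSeries w).coeff m ∈ wordSpan w S m := by
  rw [mono_eq_word]; exact coeff_word_mem _ _

theorem mul_mem_wordSpan {s t : Coeff} (hs : s ∈ S) {m : ι →₀ ℕ} (ht : t ∈ wordSpan w S m) :
    s * t ∈ wordSpan w S m := by
  induction ht using AddSubgroup.closure_induction with
  | mem t h =>
    obtain ⟨s', hs', l, rfl⟩ := h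
    rw [← mul_assoc]
    exact mul_coeff_word_mem (S.mul_mem hs hs') l m
  | zero => simp
  | add x y _ _ hx hy => rw [mul_add]; exact add_mem hx hy
  | neg x _ hx =>
    rw [show s * -x = -(s * x) from mul_neg s x]
    exact neg_mem hx

theorem isMulFamily_wordSpan : IsMulFamily w (wordSpan w S) where
  one_mem := by simpa [word] using coeff_word_mem (w := w) (S := S) [] 0
  mul_mem := by
    intro m n a b ha hb
    induction ha using AddSubgroup.closure_induction with
    | zero => simp
    | add x y _ _ hx hy => rw [add_mul, mul_add]; exact add_mem hx hy
    | neg x _ hx =>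
      rw [show qpow (reorder w m n) * (-x * b) = -(qpow (reorder w m n) * (x * b)) by ring]
      exact neg_mem hx
    | mem a h =>
      obtain ⟨s, hs, l, rfl⟩ := h
      induction hb using AddSubgroup.closure_induction with
      | zero => simp
      | add x y _ _ hx hy => rw [mul_add, mul_add]; exact add_mem hx hy
      | neg x _ hx =>
        rw [show ∀ u v : Coeff, u * (v * -x) = -(u * (v * x)) from fun u v => by ring]
        exact neg_mem hx
      | mem b h =>
        obtain ⟨s', hs', l', rfl⟩ := h
        by_cases hl : content l = m
        · by_cases hl' : content l' = n
          · subst hl hl'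
            have h := mul_coeff_word_mem (w := w) (S.mul_mem hs hs') (l ++ l')
              (content l + content l')
            rw [word_append, word_eq_coeff_smul l, word_eq_coeff_smul l', smul_mul_smul_comm,
              mono_mul_mono] at h
            simp only [coeff_smul, coeff_mono_self, mul_one] at h
            convert h using 1
            ring
          · simp [coeff_word_ne hl']
        · simp [coeff_word_ne hl]

theorem finite_support_word (c : List ι → Coeff) (m : ι →₀ ℕ) :
    (Function.support fun l => c l * (word l : QSeries w).coeff m).Finite := by
  refine (finite_content_eq m).subset fun l hl => ?_
  by_contra h
  exact hl (by simp [coeff_word_ne h])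

/-- Having word coefficients in a subring can be tested on each standard monomial separately. -/
theorem hasCoeffsIn_iff (f : QSeries w) :
    HasCoeffsIn (S : Set Coeff) f ↔ ∀ m, f.coeff m ∈ wordSpan w S m := by
  classical
  constructor
  · rintro ⟨c, hc, rfl⟩ m
    change ∑ᶠ l, c l * (word l).coeff m ∈ _
    exact finsum_induction (· ∈ wordSpan w S m) (zero_mem _) (fun _ _ => add_mem)
      fun l => mul_coeff_word_mem (hc l) l m
  · intro h
    have key : ∀ m, ∀ t ∈ wordSpan w S m, ∃ c : List ι → Coeff, (∀ l, c l ∈ S) ∧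
        t = ∑ᶠ l, c l * (word l : QSeries w).coeff m := by
      intro m t ht
      induction ht using AddSubgroup.closure_induction with
      | zero => exact ⟨0, fun _ => S.zero_mem, by simp⟩
      | add x y _ _ hx hy =>
        obtain ⟨c, hc, rfl⟩ := hx
        obtain ⟨c', hc', rfl⟩ := hy
        refine ⟨c + c', fun l => S.add_mem (hc l) (hc' l), ?_⟩
        rw [← finsum_add_distrib (finite_support_word c m) (finite_support_word c' m)]
        simp [add_mul]
      | neg x _ hx =>
        obtain ⟨c, hc, rfl⟩ := hx
        refine ⟨-c, fun l => S.neg_mem (hc l), ?_⟩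
        rw [← finsum_neg_distrib]
        exact finsum_congr fun l => (neg_mul (c l) _).symm
      | mem t h =>
        obtain ⟨s, hs, l, rfl⟩ := h
        refine ⟨Pi.single l s, fun l' => ?_, ?_⟩
        · by_cases h : l' = l
          · subst h; simpa
          · simp [h]
        · rw [finsum_eq_single _ l]
          · simp
          · intro l' hl'; simp [hl']
    choose c hc hc' using fun m => key m _ (h m)
    refine ⟨fun l => c (content l) l, fun l => hc _ l, ?_⟩
    ext m : 1
    rw [hc' m]
    refine finsum_congr fun l => ?_
    by_cases hl : content l = m
    · subst hl; rfl
    · simp [coeff_word_ne hl]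

end QSeries

/-! ### Coefficients: integrality, rationality, specialization -/

namespace Coeff

theorem coe_qQuarter_zpow (k : ℤ) : ((qQuarter ^ k : QLaurentˣ) : QLaurent) = HahnSeries.single k 1 := by
  induction k with
  | zero => rfl
  | succ n ih =>
    rw [zpow_add_one, Units.val_mul, ih]
    simp [qQuarter]
  | pred n ih =>
    rw [zpow_sub_one, Units.val_mul, ih]
    simp [qQuarter, sub_eq_add_neg]

theorem qpow_eq_C (k : ℤ) : qpow k = LaurentPolynomial.C (HahnSeries.single k 1 : QLaurent) := by
  rw [← coe_qQuarter_zpow]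
  exact (map_zpow_of_map_eq (φ := LaurentPolynomial.C (R := QLaurent)) (u := qQuarter)
    (v := qQuarterC) rfl k).symm

theorem ext_coeffAt {c c' : Coeff} (h : ∀ n e, c.coeffAt n e = c'.coeffAt n e) : c = c' :=
  LaurentPolynomial.ext fun n => HahnSeries.ext (funext fun e => h n e)

@[simp] theorem coeffAt_add (c c' : Coeff) (n e : ℤ) :
    (c + c').coeffAt n e = c.coeffAt n e + c'.coeffAt n e := by simp [coeffAt]

@[simp] theorem coeffAt_zero (n e : ℤ) : (0 : Coeff).coeffAt n e = 0 := by simp [coeffAt]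

theorem coeffAt_qpow_mul (k : ℤ) (c : Coeff) (n e : ℤ) :
    (qpow k * c).coeffAt n e = c.coeffAt n (e - k) := by
  rw [qpow_eq_C, ← LaurentPolynomial.smul_eq_C_mul, coeffAt, coeffAt]
  simp [HahnSeries.coeff_single_mul]

/-- The ring `ℤ[[q^{1/2}]]`. -/
def qSubring : Subring QLaurent where
  carrier := {f | ∀ e, f.coeff e ≠ 0 → 0 ≤ e ∧ Even e}
  zero_mem' := by intro e; simp
  one_mem' := by
    intro e h
    rw [HahnSeries.coeff_one] at h
    split_ifs at h with h0
    · subst h0; simp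
    · simp at h
  add_mem' := by
    intro f g hf hg e h
    by_cases h' : f.coeff e = 0
    · exact hg e fun h'' => h (by simp [h', h''])
    · exact hf e h'
  neg_mem' := by
    intro f hf e h
    exact hf e (by simpa using h)
  mul_mem' := by
    intro f g hf hg e h
    rw [HahnSeries.coeff_mul] at h
    obtain ⟨p, hp, hne⟩ := Finset.exists_ne_zero_of_sum_ne_zero h
    obtain ⟨h1, h2⟩ := hf p.1 (left_ne_zero_of_mul hne)
    obtain ⟨h3, h4⟩ := hg p.2 (right_ne_zero_of_mul hne)
    rw [← (Finset.mem_antidiagonal.1 hp).2.2]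
    exact ⟨add_nonneg h1 h3, h2.add h4⟩

theorem coeff_mul_mem {x y : Coeff} (hx : ∀ n, x.coeff n ∈ qSubring)
    (hy : ∀ n, y.coeff n ∈ qSubring) (n : ℤ) : (x * y).coeff n ∈ qSubring := by
  classical
  rw [AddMonoidAlgebra.coeff_mul]
  refine sum_mem fun m₁ _ => sum_mem fun m₂ _ => ?_
  dsimp only
  split_ifs
  · exact mul_mem (hx _) (hy _)
  · exact zero_mem _

theorem coeff_mul_eq_zero {x y : Coeff} (hx : ∀ n, 0 < n → x.coeff n = 0)
    (hy : ∀ n, 0 < n → y.coeff n = 0) (n : ℤ) (hn : 0 < n) : (x * y).coeff n = 0 := by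
  classical
  rw [AddMonoidAlgebra.coeff_mul]
  refine Finset.sum_eq_zero fun m₁ _ => Finset.sum_eq_zero fun m₂ _ => ?_
  dsimp only
  split_ifs with h
  · rcases lt_or_ge 0 m₁ with h1 | h1
    · rw [hx _ h1, zero_mul]
    · rw [hy m₂ (by lia), mul_zero]
  · rfl

theorem coeff_one_mem (n : ℤ) : (1 : Coeff).coeff n ∈ qSubring := by
  rw [← map_one LaurentPolynomial.C, LaurentPolynomial.C_apply]
  split_ifs
  · exact one_mem _
  · exact zero_mem _

/-- `ringR` as a subring. -/
def subringR : Subring Coeff where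
  carrier := ringR
  zero_mem' := fun _ => (zero_mem qSubring : (0 : QLaurent) ∈ qSubring)
  one_mem' := coeff_one_mem
  add_mem' := fun hx hy n => qSubring.add_mem (hx n) (hy n)
  neg_mem' := fun hx n => qSubring.neg_mem (hx n)
  mul_mem' := fun hx hy => coeff_mul_mem hx hy

theorem mem_ringRMinus {c : Coeff} :
    c ∈ ringRMinus ↔ c ∈ subringR ∧ ∀ n, 0 < n → c.coeff n = 0 := by
  refine and_congr_right fun _ => forall_congr' fun n => ⟨fun h hn => ?_, fun h e he => ?_⟩
  · ext e
    by_contra hne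
    exact absurd (h e hne) (by lia)
  · by_contra hn
    exact he (by simp [coeffAt, h (by lia)])

/-- `ringRMinus` as a subring. -/
def subringRMinus : Subring Coeff where
  carrier := ringRMinus
  zero_mem' := mem_ringRMinus.2 ⟨zero_mem _, fun _ _ => rfl⟩
  one_mem' := mem_ringRMinus.2 ⟨one_mem _, fun n hn => by
    rw [← map_one LaurentPolynomial.C, LaurentPolynomial.C_apply, if_neg hn.ne']⟩
  add_mem' := fun {x y} hx hy => by
    rw [mem_ringRMinus] at *
    exact ⟨add_mem hx.1 hy.1, fun n hn => by
      rw [AddMonoidAlgebra.coeff_add, Finsupp.add_apply, hx.2 n hn, hy.2 n hn, add_zero]⟩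
  neg_mem' := fun {x} hx => by
    rw [mem_ringRMinus] at *
    exact ⟨neg_mem hx.1, fun n hn => by
      rw [AddMonoidAlgebra.coeff_neg, Finsupp.neg_apply, hx.2 n hn, neg_zero]⟩
  mul_mem' := fun {x y} hx hy => by
    rw [mem_ringRMinus] at *
    exact ⟨mul_mem hx.1 hy.1, coeff_mul_eq_zero hx.2 hy.2⟩

theorem subringRMinus_le : subringRMinus ≤ subringR := fun _ h => h.1

theorem C_mem_subringRMinus {f : QLaurent} (hf : f ∈ qSubring) :
    LaurentPolynomial.C f ∈ subringRMinus := by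
  refine mem_ringRMinus.2 ⟨fun n => ?_, fun n hn => ?_⟩
  · change (LaurentPolynomial.C f).coeff n ∈ qSubring
    rw [LaurentPolynomial.C_apply]
    split_ifs
    · exact hf
    · exact zero_mem _
  · rw [LaurentPolynomial.C_apply, if_neg hn.ne']

theorem single_mem_qSubring {k : ℤ} (hk : 0 ≤ k) (h2 : Even k) :
    (HahnSeries.single k 1 : QLaurent) ∈ qSubring := by
  intro e he
  rw [HahnSeries.coeff_single] at he
  split_ifs at he with h
  · exact h ▸ ⟨hk, h2⟩
  · exact absurd rfl he

theorem qpow_mem_subringRMinus {k : ℤ} (hk : 0 ≤ k) (h2 : Even k) : qpow k ∈ subringRMinus := by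
  rw [qpow_eq_C]; exact C_mem_subringRMinus (single_mem_qSubring hk h2)

theorem T_mem_subringR (k : ℤ) : (LaurentPolynomial.T k : Coeff) ∈ subringR := by
  intro n
  change (LaurentPolynomial.T k : Coeff).coeff n ∈ qSubring
  rw [LaurentPolynomial.T_apply]
  split_ifs
  · exact one_mem _
  · exact zero_mem _

theorem T_mem_subringRMinus {k : ℤ} (hk : k ≤ 0) :
    (LaurentPolynomial.T k : Coeff) ∈ subringRMinus := by
  refine mem_ringRMinus.2 ⟨T_mem_subringR k, fun n hn => ?_⟩
  rw [LaurentPolynomial.T_apply, if_neg (by lia)]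

/-- The geometric series: `1 - q^k` is invertible in `ℤ[[q^{1/2}]]`. -/
theorem exists_geom {k : ℤ} (hk : 0 < k) : ∃ g ∈ subringRMinus, (1 - qpow (4 * k)) * g = 1 := by
  classical
  obtain ⟨G, hc⟩ : ∃ G : QLaurent, ∀ e, G.coeff e = if 0 ≤ e ∧ 4 * k ∣ e then 1 else 0 :=
    ⟨HahnSeries.ofSuppBddBelow _ ⟨0, fun e he => by
      by_contra h
      exact Function.mem_support.1 he (if_neg fun h' => h h'.1)⟩, fun e => rfl⟩
  refine ⟨LaurentPolynomial.C G, C_mem_subringRMinus fun e he => ?_, ?_⟩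
  · rw [hc] at he
    split_ifs at he with h
    · obtain ⟨c, rfl⟩ := h.2
      exact ⟨h.1, ⟨2 * k * c, by ring⟩⟩
    · exact absurd rfl he
  · rw [qpow_eq_C, ← map_one LaurentPolynomial.C, ← map_sub, ← map_mul, sub_mul, one_mul]
    congr 1
    ext e
    rw [HahnSeries.coeff_sub, HahnSeries.coeff_single_mul, HahnSeries.coeff_one, one_mul, hc, hc]
    have hd : 4 * k ∣ e - 4 * k ↔ 4 * k ∣ e := by simp
    simp only [hd]
    by_cases h0 : e = 0
    · subst h0
      have : ¬ 4 * k ≤ 0 := by lia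
      simp [this]
    · by_cases hdvd : 4 * k ∣ e
      · have : 4 * k ≤ e ↔ 0 ≤ e := by
          constructor
          · lia
          · intro he
            exact Int.le_of_dvd (lt_of_le_of_ne he (Ne.symm h0)) hdvd
        simp [this, h0]
      · simp [hdvd, h0]

/-- The evaluation of polynomials in two variables at `q^{1/2}` and `a^{1/2}`. -/
def aevalQA : MvPolynomial (Fin 2) ℤ →ₐ[ℤ] Coeff :=
  MvPolynomial.aeval ![(qHalf : Coeff), (aHalf : Coeff)]

/-- The elements of the coefficient ring that are rational functions of `q^{1/2}` and `a^{1/2}`. -/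
def ratSubring : Subring Coeff where
  carrier := {h | ∃ num den : MvPolynomial (Fin 2) ℤ, den ≠ 0 ∧ aevalQA den * h = aevalQA num}
  zero_mem' := ⟨0, 1, one_ne_zero, by simp⟩
  one_mem' := ⟨1, 1, one_ne_zero, by simp⟩
  add_mem' := by
    rintro x y ⟨n, d, hd, h⟩ ⟨n', d', hd', h'⟩
    refine ⟨d' * n + d * n', d * d', mul_ne_zero hd hd', ?_⟩
    simp only [map_add, map_mul, ← h, ← h']
    ring
  neg_mem' := by
    rintro x ⟨n, d, hd, h⟩
    refine ⟨-n, d, hd, ?_⟩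
    rw [map_neg, ← h]
    ring
  mul_mem' := by
    rintro x y ⟨n, d, hd, h⟩ ⟨n', d', hd', h'⟩
    refine ⟨n * n', d * d', mul_ne_zero hd hd', ?_⟩
    simp only [map_mul, ← h, ← h']
    ring

theorem mem_ratSubring_of_aevalQA_mul {p : MvPolynomial (Fin 2) ℤ} (hp : p ≠ 0) {c : Coeff}
    (h : aevalQA p * c ∈ ratSubring) : c ∈ ratSubring := by
  obtain ⟨n, d, hd, h⟩ := h
  exact ⟨n, d * p, mul_ne_zero hd hp, by rw [← h, map_mul, mul_assoc]⟩

theorem aevalQA_mem (p : MvPolynomial (Fin 2) ℤ) : aevalQA p ∈ ratSubring :=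
  ⟨p, 1, one_ne_zero, by simp⟩

theorem zpow_mem_ratSubring {u : Coeffˣ} (i : Fin 2)
    (hu : aevalQA (MvPolynomial.X i) = (u : Coeff)) (k : ℤ) :
    ((u ^ k : Coeffˣ) : Coeff) ∈ ratSubring := by
  have h1 : (u : Coeff) ∈ ratSubring := hu ▸ aevalQA_mem _
  have h2 : ((u⁻¹ : Coeffˣ) : Coeff) ∈ ratSubring :=
    mem_ratSubring_of_aevalQA_mul (MvPolynomial.X_ne_zero i) (by rw [hu]; simp)
  cases k with
  | ofNat n => simpa using pow_mem h1 n
  | negSucc n => simpa [← inv_pow] using pow_mem h2 (n + 1)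

theorem aHalf_zpow_mem_ratSubring (k : ℤ) : ((aHalf ^ k : Coeffˣ) : Coeff) ∈ ratSubring :=
  zpow_mem_ratSubring 1 (by simp [aevalQA]) k

theorem qHalf_zpow (k : ℤ) : ((qHalf ^ k : Coeffˣ) : Coeff) = qpow (2 * k) := by
  rw [qHalf, qpow, zpow_mul]
  rfl

theorem qHalf_sq_zpow (k : ℤ) : (((qHalf ^ 2) ^ k : Coeffˣ) : Coeff) = qpow (4 * k) := by
  rw [← zpow_natCast, ← zpow_mul, qHalf_zpow]
  congr 1
  push_cast
  ring

theorem qpow_mem_ratSubring {k : ℤ} (hk : Even k) : qpow k ∈ ratSubring := by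
  obtain ⟨j, rfl⟩ := hk
  rw [← two_mul, ← qHalf_zpow]
  exact zpow_mem_ratSubring 0 (by simp [aevalQA]) j

theorem mem_ratSubring_of_geom {k : ℤ} (hk : 0 < k) {c : Coeff}
    (h : (1 - qpow (4 * k)) * c ∈ ratSubring) : c ∈ ratSubring := by
  lift k to ℕ using hk.le
  refine mem_ratSubring_of_aevalQA_mul (p := 1 - MvPolynomial.X 0 ^ (2 * k)) ?_ ?_
  · intro h0
    have := congrArg (MvPolynomial.eval 0) h0
    have hk' : k ≠ 0 := by lia
    simp [hk'] at this
  · convert h using 2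
    rw [show (4 * k : ℤ) = 2 * (2 * k : ℕ) by push_cast; ring, ← qHalf_zpow, zpow_natCast]
    simp [aevalQA]

/-! ### Uniqueness of the interpolation in `N` -/

/-- A coefficient is determined by its values at `a = q^N`: a Laurent polynomial over a domain has only
finitely many roots. -/
theorem eq_zero_of_specA_eq_zero {c : Coeff} (h : ∀ N : ℕ, 1 ≤ N → specA N c = 0) : c = 0 := by
  obtain ⟨n, p, hp⟩ := LaurentPolynomial.exists_T_pow c
  have hroot : ∀ N : ℕ, 1 ≤ N → p.IsRoot ((qQuarter ^ (2 * N) : QLaurentˣ) : QLaurent) := by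
    intro N hN
    have := congrArg (specA N) hp
    rw [map_mul, h N hN, zero_mul, specA, LaurentPolynomial.eval₂_toLaurent] at this
    exact this
  have hp0 : p = 0 := by
    refine Polynomial.eq_zero_of_infinite_isRoot p (Set.Infinite.mono (s := Set.range fun N : ℕ =>
      ((qQuarter ^ (2 * (N + 1)) : QLaurentˣ) : QLaurent)) ?_ (Set.infinite_range_of_injective ?_))
    · rintro _ ⟨N, rfl⟩
      exact hroot (N + 1) (by lia)
    · intro N N' hNN
      simp only [← zpow_natCast, coe_qQuarter_zpow] at hNN
      have := congrArg (fun f : QLaurent => f.coeff ((2 * (N + 1) : ℕ) : ℤ)) hNN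
      simp only [HahnSeries.coeff_single_same, HahnSeries.coeff_single] at this
      split_ifs at this with h'
      · lia
      · simp at this
  rw [hp0, map_zero] at hp
  have := congrArg (· * LaurentPolynomial.T (-(n : ℤ))) hp
  simpa [LaurentPolynomial.mul_T_assoc] using this.symm

end Coeff

namespace QSeries

open Finset.HasAntidiagonal (antidiagonal mem_antidiagonal)

/-! ### The infinite product -/

variable {ι : Type} {w : ι → ι → ℤ}

theorem HasLimit.unique {u : ℕ → QSeries w} {f g : QSeries w} (hf : HasLimit u f)
    (hg : HasLimit u g) : f = g := by
  ext m : 1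
  refine Coeff.ext_coeffAt fun n e => ?_
  obtain ⟨K, hK⟩ := hf m n e
  obtain ⟨K', hK'⟩ := hg m n e
  rw [← hK (max K K') (le_max_left _ _) e le_rfl, hK' (max K K') (le_max_right _ _) e le_rfl]

/-- Convergence to `0` of a sequence of coefficients, in the `q`-adic topology. -/
def TendsToZero (u : ℕ → Coeff) : Prop :=
  ∀ n B : ℤ, ∃ K : ℕ, ∀ k ≥ K, ∀ e ≤ B, (u k).coeffAt n e = 0

theorem TendsToZero.sum {σ : Type*} (s : Finset σ) (u : σ → ℕ → Coeff)
    (h : ∀ i ∈ s, TendsToZero (u i)) : TendsToZero fun k => ∑ i ∈ s, u i k := by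
  classical
  induction s using Finset.induction_on with
  | empty => exact fun n B => ⟨0, fun k _ e _ => by simp⟩
  | insert a s ha ih =>
    intro n B
    obtain ⟨K, hK⟩ := h a (Finset.mem_insert_self _ _) n B
    obtain ⟨K', hK'⟩ := ih (fun i hi => h i (Finset.mem_insert_of_mem hi)) n B
    refine ⟨max K K', fun k hk e he => ?_⟩
    beta_reduce
    rw [Finset.sum_insert ha, Coeff.coeffAt_add, hK k (le_trans (le_max_left _ _) hk) e he,
      hK' k (le_trans (le_max_right _ _) hk) e he, add_zero]

theorem tendsToZero_qpow_mul {k : ℤ} (hk : 0 < k) (c : Coeff) :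
    TendsToZero fun n => qpow (n * k) * c := by
  intro j B
  refine ⟨(B - HahnSeries.order (AddMonoidAlgebra.coeff c j) + 1).toNat, fun n hn e he => ?_⟩
  rw [Coeff.coeffAt_qpow_mul]
  refine HahnSeries.coeff_eq_zero_of_lt_order ?_
  have h1 : B - HahnSeries.order (AddMonoidAlgebra.coeff c j) + 1 ≤ n := Int.toNat_le.1 hn
  nlinarith

variable [Fintype ι] [LinearOrder ι]

/-- The factors `B(q^{n d i} X i)` tend to `1` if `B` has constant coefficient `1`. -/
theorem hasLimit_mul_scale {d : ι → ℤ} (hd : ∀ i, 0 < d i) (A B : QSeries w)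
    (hB : B.coeff 0 = 1) : HasLimit (fun n => A * scale d ((qHalf ^ 2) ^ n) B) A := by
  have key : ∀ m, TendsToZero fun n => (A * scale d ((qHalf ^ 2) ^ n) (B - 1)).coeff m := by
    intro m
    simp only [coeff_mul]
    refine TendsToZero.sum _ _ fun p _ => ?_
    by_cases hp : p.2 = 0
    · have h0 : (B - 1).coeff 0 = 0 := by
        rw [sub_eq_add_neg, coeff_add, hB]
        exact add_neg_cancel (1 : Coeff)
      intro n C
      exact ⟨0, fun k _ e _ => by simp only [hp, coeff_scale, h0]; simp⟩
    · have := tendsToZero_qpow_mul (mul_pos (by norm_num : (0 : ℤ) < 4) (wdeg_pos hd hp))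
        (qpow (reorder w p.1 p.2) * (A.coeff p.1 * (B - 1).coeff p.2))
      convert this using 2 with n
      have hq : (((qHalf ^ 2) ^ n) ^ wdeg d p.2 : Coeffˣ) = qQuarterC ^ (n * (4 * wdeg d p.2)) := by
        rw [qHalf, ← pow_mul, ← pow_mul, ← zpow_natCast, ← zpow_mul]
        congr 1
        push_cast
        ring
      rw [coeff_scale, hq, ← qpow]
      ring
  intro m n C
  obtain ⟨K, hK⟩ := key m n C
  refine ⟨K, fun k hk e he => ?_⟩
  have : A * scale d ((qHalf ^ 2) ^ k) B = A + A * scale d ((qHalf ^ 2) ^ k) (B - 1) := by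
    rw [map_sub, map_one, mul_sub, mul_one]; abel
  beta_reduce
  rw [this, coeff_add, Coeff.coeffAt_add, hK k hk e he, add_zero]

/-- The series `1 + ∑ X i`. -/
def linSeries (w : ι → ι → ℤ) : QSeries w := 1 + ∑ i, X i

theorem coeff_linSeries_zero : (linSeries w).coeff 0 = 1 := by
  rw [linSeries, coeff_add, coeff_sum, coeff_one_zero, Finset.sum_eq_zero, add_zero]
  intro i _
  exact coeff_mono_ne (by simp [eq_comm])

/-- The finite products of `1 + ∑ q^{k d i} X i`, for `k` from `0` to `n - 1`. -/
def linProd (w : ι → ι → ℤ) (d : ι → ℤ) (n : ℕ) : QSeries w :=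
  ((List.range n).map fun k => scale d ((qHalf ^ 2) ^ k) (linSeries w)).prod

theorem eq_mul_add_of_one_sub_mul {R : Type*} [CommRing R] {t g s x : R} (h : (1 - t) * g = 1)
    (hx : x = g * s) : x = t * x + s := by
  subst hx
  linear_combination s * h

/-- The `q`-difference equation `E(X) = (1 + ∑ X i) E(q^{d i} X i)` has a solution with constant
coefficient `1`: the coefficient of a monomial of degree `k > 0` enters with the factor `1 - q^k`. -/
theorem exists_qDifference (w : ι → ι → ℤ) {d : ι → ℤ} (hd : ∀ i, 0 < d i) :
    ∃ E : QSeries w, E.coeff 0 = 1 ∧ E = linSeries w * scale d (qHalf ^ 2) E := by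
  choose! g _ hg using fun (k : ℤ) (hk : 0 < k) => Coeff.exists_geom hk
  obtain ⟨f, hf⟩ := exists_recursion (w := w) (fun m f => if m = 0 then 1 else
    g (wdeg d m) * ∑ p ∈ (antidiagonal m).filter (fun p => p.2 ≠ m),
        qpow (reorder w p.1 p.2) * ((linSeries w).coeff p.1 * (qpow (4 * wdeg d p.2) * f p.2))) (by
      intro m f₁ f₂ H
      split_ifs
      · rfl
      · refine congrArg (g (wdeg d m) * ·) (Finset.sum_congr rfl fun p hp => ?_)
        rw [H _ (lt_of_mem_antidiagonal hp)])
  refine ⟨f, by simp [hf 0], ?_⟩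
  ext m : 1
  rw [coeff_mul_eq_add, coeff_linSeries_zero, one_mul, coeff_scale, Coeff.qHalf_sq_zpow]
  by_cases h : m = 0
  · subst h
    simp [Finset.filter_singleton]
  · have h1 := hf m
    rw [if_neg h] at h1
    have h2 := hg _ (wdeg_pos hd h)
    simp only [coeff_scale, Coeff.qHalf_sq_zpow]
    exact eq_mul_add_of_one_sub_mul h2 h1

/-- The infinite product `∏ (1 + ∑ q^{k d i} X i)`. -/
def linProdInf (w : ι → ι → ℤ) {d : ι → ℤ} (hd : ∀ i, 0 < d i) : QSeries w :=
  Classical.choose (exists_qDifference w hd)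

variable {d : ι → ℤ} (hd : ∀ i, 0 < d i)

theorem coeff_linProdInf_zero : (linProdInf w hd).coeff 0 = 1 :=
  (Classical.choose_spec (exists_qDifference w hd)).1

theorem linProdInf_eq : linProdInf w hd = linSeries w * scale d (qHalf ^ 2) (linProdInf w hd) :=
  (Classical.choose_spec (exists_qDifference w hd)).2

/-- Splitting off the first `n` factors. -/
theorem linProdInf_eq_linProd_mul (n : ℕ) :
    linProdInf w hd = linProd w d n * scale d ((qHalf ^ 2) ^ n) (linProdInf w hd) := by
  induction n with
  | zero => simp [linProd]
  | succ n ih =>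
    have h := congrArg (scale d ((qHalf ^ 2) ^ n)) (linProdInf_eq (w := w) hd)
    rw [map_mul, scale_scale, ← pow_succ] at h
    rw [h, ← mul_assoc] at ih
    rw [linProd, List.range_succ, List.map_append, List.prod_append]
    simpa [linProd] using ih

theorem linProd_eq_mul {G : QSeries w} (hG : linProdInf w hd * G = 1) (n : ℕ) :
    linProd w d n = linProdInf w hd * scale d ((qHalf ^ 2) ^ n) G := by
  conv_rhs => rw [linProdInf_eq_linProd_mul hd n]
  rw [mul_assoc, ← map_mul, hG, map_one, mul_one]

theorem hasLimit_scale_linProd (u : Coeffˣ) :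
    HasLimit (fun n => scale d u (linProd w d n)) (scale d u (linProdInf w hd)) := by
  obtain ⟨G, hG, hEG, -⟩ := exists_inv (linProdInf w hd) (coeff_linProdInf_zero hd)
  have hn (n : ℕ) : scale d u (linProd w d n) =
      scale d u (linProdInf w hd) * scale d ((qHalf ^ 2) ^ n) (scale d u G) := by
    rw [linProd_eq_mul hd hEG, map_mul, scale_scale, scale_scale, mul_comm u]
  simp only [hn]
  exact hasLimit_mul_scale hd _ _ (by simp [hG])

/-- The coefficients of the infinite product lie in every multiplicative family that contains the
coefficients of `1 + ∑ X i` and admits multiplication by powers of `q` and division by `1 - q^k`. -/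
theorem coeff_linProdInf_mem {B : (ι →₀ ℕ) → AddSubgroup Coeff} (hB : IsMulFamily w B)
    (hX : ∀ i m, (X i : QSeries w).coeff m ∈ B m)
    (hq : ∀ k m, ∀ c ∈ B m, 0 ≤ k → qpow (4 * k) * c ∈ B m)
    (hg : ∀ k m c, 0 < k → (1 - qpow (4 * k)) * c ∈ B m → c ∈ B m) (m) :
    (linProdInf w hd).coeff m ∈ B m := by
  have hL (m) : (linSeries w).coeff m ∈ B m := by
    rw [linSeries, coeff_add, coeff_sum]
    exact add_mem (hB.coeff_one_mem m) (sum_mem fun i _ => hX i m)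
  induction m using WellFoundedLT.induction with
  | ind m ih =>
    by_cases h : m = 0
    · subst h
      rw [coeff_linProdInf_zero]; exact hB.one_mem
    have h1 := congrArg (fun s => s.coeff m) (linProdInf_eq (w := w) hd)
    simp only [coeff_mul_eq_add, coeff_linSeries_zero, one_mul, coeff_scale, Coeff.qHalf_sq_zpow] at h1
    refine hg (wdeg d m) m _ (wdeg_pos hd h) ?_
    have h2 : (1 - qpow (4 * wdeg d m)) * (linProdInf w hd).coeff m =
        (linProdInf w hd).coeff m - qpow (4 * wdeg d m) * (linProdInf w hd).coeff m := by ring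
    rw [h2]
    nth_rewrite 1 [h1]
    rw [add_sub_cancel_left]
    refine sum_mem fun p hp => ?_
    exact hB.mul_mem_of_mem_antidiagonal (Finset.mem_filter.1 hp).1 (hL _)
      (hq _ _ _ (ih _ (lt_of_mem_antidiagonal hp)) (wdeg_nonneg hd _))

end QSeries

namespace QSeries

open Finset.HasAntidiagonal (antidiagonal mem_antidiagonal)

/-! ### Monomial maps -/

section ExpMap

variable {ι κ : Type} [Fintype ι]

/-- The total exponents of the image of a monomial when each `X i` is sent to the standard monomial
with exponents `y i`. -/
def expMap (y : ι → κ →₀ ℕ) (n : ι →₀ ℕ) : κ →₀ ℕ := ∑ i, n i • y i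

theorem expMap_add (y : ι → κ →₀ ℕ) (m n : ι →₀ ℕ) :
    expMap y (m + n) = expMap y m + expMap y n := by
  simp [expMap, add_smul, Finset.sum_add_distrib]

theorem expMap_single (y : ι → κ →₀ ℕ) (i : ι) : expMap y (Finsupp.single i 1) = y i := by
  classical
  rw [expMap, Finset.sum_eq_single i]
  · simp
  · intro j _ hj; simp [hj]
  · simp

/-- A monomial has finitely many preimages, because each variable raises the total degree. -/
theorem finite_expMap_eq {y : ι → κ →₀ ℕ} (hy : ∀ i, y i ≠ 0) (M : κ →₀ ℕ) :
    {n | expMap y n = M}.Finite := by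
  classical
  refine (Set.finite_Iic (Finsupp.equivFunOnFinite.symm fun _ : ι => M.degree)).subset ?_
  rintro n rfl i
  have h1 : (expMap y n).degree = ∑ j, n j * (y j).degree := by
    rw [expMap, map_sum]; simp
  change n i ≤ (expMap y n).degree
  rw [h1]
  refine le_trans ?_ (Finset.single_le_sum (f := fun j => n j * (y j).degree)
    (fun _ _ => Nat.zero_le _) (Finset.mem_univ i))
  exact Nat.le_mul_of_pos_right _ (Nat.pos_of_ne_zero fun h =>
    hy i ((Finsupp.degree_eq_zero_iff _).1 h))

theorem sum_map_eq_expMap (y : ι → κ →₀ ℕ) (l : List ι) :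
    (l.map y).sum = expMap y (content l) := by
  induction l with
  | nil => simp [expMap]
  | cons a l ih => rw [List.map_cons, List.sum_cons, content_cons, expMap_add, expMap_single, ih]

end ExpMap

variable {ι : Type} [Fintype ι] [LinearOrder ι]

theorem reorder_sum_left (w : ι → ι → ℤ) {σ : Type} (m : ι →₀ ℕ) (y : σ → ι →₀ ℕ) (l : List σ) :
    reorder w (l.map y).sum m = (l.map fun i => reorder w (y i) m).sum := by
  induction l with
  | nil => simp
  | cons a l ih => simp [reorder_add_left, ih]

/-- For an alternating `b`, the sum over the pairs of entries of a sorted list is a quadratic function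
of its content. -/
theorem pairSum_of_sorted {b : ι → ι → ℤ} (hb : ∀ i j, b j i = -b i j) {l : List ι}
    (hl : l.Pairwise (· ≤ ·)) : pairSum b l = -reorder b (content l) (content l) := by
  induction l with
  | nil => simp [pairSum]
  | cons a l ih =>
    rw [List.pairwise_cons] at hl
    have h1 : reorder b (Finsupp.single a 1) (content l) = 0 := by
      rw [content, reorder_sum_right]
      refine List.sum_eq_zero fun t ht => ?_
      obtain ⟨j, hj, rfl⟩ := List.mem_map.1 ht
      rw [reorder_single, if_neg (hl.1 j hj).not_gt]
    have h2 : reorder b (content l) (Finsupp.single a 1) = -(l.map (b a)).sum := by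
      rw [content, reorder_sum_left, List.sum_neg, List.map_map]
      congr 1
      refine List.map_congr_left fun j hj => ?_
      rw [reorder_single, Function.comp_apply]
      split_ifs with h
      · exact hb _ _
      · obtain rfl : a = j := le_antisymm (hl.1 j hj) (not_lt.1 h)
        have := hb a a
        lia
    rw [pairSum, ih hl.2, content_cons, reorder_add_left, reorder_add_right, reorder_add_right, h1,
      h2, reorder_single, if_neg (lt_irrefl a)]
    ring

/-- For alternating exponents, reordering is compatible with a monomial map up to the antisymmetrized
reordering of the source. -/
theorem reorder_expMap {κ : Type} [Fintype κ] [LinearOrder κ] {w' : κ → κ → ℤ} (y : ι → κ →₀ ℕ)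
    (hb : ∀ i j, reorder w' (y j) (y i) = -reorder w' (y i) (y j)) (m n : ι →₀ ℕ) :
    reorder w' (expMap y m) (expMap y n) =
      reorder (fun i j => reorder w' (y i) (y j)) m n -
        reorder (fun i j => reorder w' (y i) (y j)) n m := by
  have h1 : reorder w' (expMap y m) (expMap y n) =
      ∑ i, ∑ j, reorder w' (y i) (y j) * (m i : ℤ) * (n j : ℤ) := by
    have hl (M : κ →₀ ℕ) : reorder w' (expMap y m) M = ∑ i, m i * reorder w' (y i) M := by
      let φ : (κ →₀ ℕ) →+ ℤ :=
        { toFun := fun M' => reorder w' M' M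
          map_zero' := reorder_zero_left _
          map_add' := fun _ _ => reorder_add_left _ _ _ }
      change φ (∑ i, m i • y i) = _
      simp only [map_sum, map_nsmul, nsmul_eq_mul]
      rfl
    have hr (M : κ →₀ ℕ) : reorder w' M (expMap y n) = ∑ i, n i * reorder w' M (y i) := by
      let φ : (κ →₀ ℕ) →+ ℤ :=
        { toFun := fun M' => reorder w' M M'
          map_zero' := reorder_zero_right _
          map_add' := fun _ _ => reorder_add_right _ _ _ }
      change φ (∑ i, n i • y i) = _
      simp only [map_sum, map_nsmul, nsmul_eq_mul]
      rfl
    rw [hl]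
    refine Finset.sum_congr rfl fun i _ => ?_
    rw [hr, Finset.mul_sum]
    exact Finset.sum_congr rfl fun j _ => by ring
  have h2 : reorder (fun i j => reorder w' (y i) (y j)) n m =
      ∑ i, ∑ j, if i < j then reorder w' (y j) (y i) * (n j : ℤ) * (m i : ℤ) else 0 :=
    Finset.sum_comm
  rw [h1, h2, reorder, ← Finset.sum_sub_distrib]
  refine Finset.sum_congr rfl fun i _ => ?_
  rw [← Finset.sum_sub_distrib]
  refine Finset.sum_congr rfl fun j _ => ?_
  rcases lt_trichotomy i j with h | rfl | h
  · rw [if_neg h.not_gt, if_pos h, hb i j]; ring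
  · have := hb i i
    have h0 : reorder w' (y i) (y i) = 0 := by lia
    simp [h0]
  · rw [if_pos h, if_neg h.not_gt]; ring

theorem even_reorder {b : ι → ι → ℤ} (hb : ∀ i j, Even (b i j)) (m n : ι →₀ ℕ) :
    Even (reorder b m n) := by
  refine Finset.even_sum _ fun i _ => Finset.even_sum _ fun j _ => ?_
  split_ifs
  · exact ((hb i j).mul_right _).mul_right _
  · exact Even.zero

variable {w : ι → ι → ℤ} {κ : Type} [Fintype κ] [LinearOrder κ] {w' : κ → κ → ℤ}

/-- The map that sends a standard monomial `X i₁ ⋯ X iₖ` to the product of the standard monomials with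
exponents `y i₁`, …, `y iₖ`, extended to series. -/
def monoMap (w' : κ → κ → ℤ) (y : ι → κ →₀ ℕ) (f : QSeries w) : QSeries w' :=
  formalSum f.coeff fun n => (((Finsupp.toMultiset n).sort (· ≤ ·)).map fun i => mono (y i)).prod

/-- The conditions under which a monomial map is a ring homomorphism of series: the images of the
variables commute in the same way as the variables, and they are not constant. -/
structure IsMonoMap (w : ι → ι → ℤ) (w' : κ → κ → ℤ) (y : ι → κ →₀ ℕ) : Prop where
  ne_zero : ∀ i, y i ≠ 0
  alt : ∀ i j, reorder w' (y j) (y i) = -reorder w' (y i) (y j)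
  comm : ∀ i j, w i j = 2 * reorder w' (y i) (y j)

/-- The exponent of `q^{1/4}` in the image of a standard monomial under a monomial map. -/
def monoExp (w' : κ → κ → ℤ) (y : ι → κ →₀ ℕ) (n : ι →₀ ℕ) : ℤ :=
  -reorder (fun i j => reorder w' (y i) (y j)) n n

namespace IsMonoMap

variable {y : ι → κ →₀ ℕ} (hy : IsMonoMap w w' y)
include hy

theorem prod_sort (n : ι →₀ ℕ) :
    ((((Finsupp.toMultiset n).sort (· ≤ ·)).map fun i => mono (y i)).prod : QSeries w') =
      qpow (monoExp w' y n) • mono (expMap y n) := by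
  rw [prod_map_mono, pairSum_of_sorted hy.alt (Multiset.pairwise_sort _ _), sum_map_eq_expMap,
    content_sort, monoExp]

theorem monoExp_add (m n : ι →₀ ℕ) : monoExp w' y (m + n) + reorder w m n =
    monoExp w' y m + monoExp w' y n + reorder w' (expMap y m) (expMap y n) := by
  have h : reorder w m n = 2 * reorder (fun i j => reorder w' (y i) (y j)) m n := by
    rw [reorder, reorder, Finset.mul_sum]
    refine Finset.sum_congr rfl fun i _ => ?_
    rw [Finset.mul_sum]
    refine Finset.sum_congr rfl fun j _ => ?_
    split_ifs
    · rw [hy.comm]; ring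
    · simp
  rw [reorder_expMap y hy.alt, h]
  simp only [monoExp, reorder_add_left, reorder_add_right]
  ring

theorem coeff_monoMap (f : QSeries w) (M : κ →₀ ℕ) : (monoMap w' y f).coeff M =
    ∑ n ∈ (finite_expMap_eq hy.ne_zero M).toFinset, qpow (monoExp w' y n) * f.coeff n := by
  change ∑ᶠ n, f.coeff n * _ = _
  simp only [hy.prod_sort, coeff_smul]
  have h0 (n) (hn : expMap y n ≠ M) :
      f.coeff n * (qpow (monoExp w' y n) * (mono (expMap y n) : QSeries w').coeff M) = 0 := by
    rw [coeff_mono_ne hn.symm, mul_zero, mul_zero]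
  rw [finsum_eq_sum_of_support_subset (s := (finite_expMap_eq hy.ne_zero M).toFinset)]
  · refine Finset.sum_congr rfl fun n hn => ?_
    have : expMap y n = M := by simpa using hn
    rw [this, coeff_mono_self]
    ring
  · intro n hn
    by_contra h
    exact hn (h0 n (by simpa using h))

theorem monoMap_mono (n : ι →₀ ℕ) : monoMap w' y (mono n : QSeries w) =
    qpow (monoExp w' y n) • mono (expMap y n) := by
  ext M : 1
  rw [← hy.prod_sort]
  change ∑ᶠ k, (mono n : QSeries w).coeff k * _ = _
  rw [finsum_eq_single _ n]
  · rw [coeff_mono_self, one_mul]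
  · intro k hk; rw [coeff_mono_ne hk, zero_mul]

/-- The monomial map as a ring homomorphism. -/
def toRingHom : QSeries w →+* QSeries w' where
  toFun := monoMap w' y
  map_one' := by
    rw [one_eq_mono, hy.monoMap_mono]
    simp [monoExp, expMap, one_eq_mono]
  map_zero' := by ext M : 1; simp [hy.coeff_monoMap]
  map_add' f g := by
    ext M : 1
    simp [hy.coeff_monoMap, mul_add, Finset.sum_add_distrib]
  map_mul' f g := by
    ext M : 1
    simp only [hy.coeff_monoMap, coeff_mul, Finset.sum_mul_sum, ← Finset.sum_product']
    simp only [Finset.mul_sum, Finset.sum_sigma']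
    apply Finset.sum_nbij' (fun ⟨_, m, n⟩ ↦ ⟨(expMap y m, expMap y n), (m, n)⟩)
      (fun ⟨_, m, n⟩ ↦ ⟨m + n, (m, n)⟩)
    · rintro ⟨k, m, n⟩ h
      simp only [Finset.mem_sigma, mem_antidiagonal, Set.Finite.mem_toFinset, Set.mem_ofPred_eq] at h
      simp [← h.1, ← h.2, expMap_add]
    · rintro ⟨⟨M₁, M₂⟩, m, n⟩ h
      simp only [Finset.mem_sigma, mem_antidiagonal, Finset.mem_product, Set.Finite.mem_toFinset,
        Set.mem_ofPred_eq] at h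
      simp [← h.1, ← h.2.1, ← h.2.2, expMap_add]
    · rintro ⟨k, m, n⟩ h
      simp only [Finset.mem_sigma, mem_antidiagonal] at h
      simp [h.2]
    · rintro ⟨⟨M₁, M₂⟩, m, n⟩ h
      simp only [Finset.mem_sigma, Finset.mem_product, Set.Finite.mem_toFinset,
        Set.mem_ofPred_eq] at h
      simp [h.2.1, h.2.2]
    · rintro ⟨k, m, n⟩ h
      simp only [Finset.mem_sigma, mem_antidiagonal] at h
      have e : qpow (monoExp w' y k) * qpow (reorder w m n) =
          qpow (reorder w' (expMap y m) (expMap y n)) *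
            (qpow (monoExp w' y m) * qpow (monoExp w' y n)) := by
        rw [← qpow_add, ← qpow_add, ← qpow_add, ← h.2, hy.monoExp_add, add_comm]
      linear_combination (f.coeff m * g.coeff n) * e

@[simp] theorem toRingHom_apply (f : QSeries w) : hy.toRingHom f = monoMap w' y f := rfl

theorem monoMap_X (i : ι) : monoMap w' y (X i : QSeries w) = mono (y i) := by
  rw [X, hy.monoMap_mono, expMap_single, monoExp, reorder_single, if_neg (lt_irrefl i), neg_zero,
    qpow_zero, one_smul]

theorem monoMap_smul (c : Coeff) (f : QSeries w) : monoMap w' y (c • f) = c • monoMap w' y f := by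
  ext M : 1
  simp only [hy.coeff_monoMap, coeff_smul, Finset.mul_sum]
  exact Finset.sum_congr rfl fun n _ => by ring

theorem mapHom_monoMap (φ : Coeff →+* Coeff) (hφ : φ qQuarterC = qQuarterC) (f : QSeries w) :
    mapHom φ hφ (monoMap w' y f) = monoMap w' y (mapHom φ hφ f) := by
  ext M : 1
  simp [hy.coeff_monoMap, map_qpow hφ]

theorem exists_expMap_eq {f : QSeries w} {M : κ →₀ ℕ} (h : (monoMap w' y f).coeff M ≠ 0) :
    ∃ n, expMap y n = M := by
  rw [hy.coeff_monoMap] at h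
  obtain ⟨n, hn, -⟩ := Finset.exists_ne_zero_of_sum_ne_zero h
  exact ⟨n, by simpa using hn⟩

theorem coeff_monoMap_mem_ratSubring (he : ∀ i j, Even (reorder w' (y i) (y j))) {f : QSeries w}
    (hf : ∀ n, f.coeff n ∈ Coeff.ratSubring) (M) :
    (monoMap w' y f).coeff M ∈ Coeff.ratSubring := by
  rw [hy.coeff_monoMap]
  exact sum_mem fun n _ => mul_mem (Coeff.qpow_mem_ratSubring (even_reorder he n n).neg) (hf n)

/-- Monomial maps send words to words, and so preserve integrality of word coefficients. -/
theorem hasCoeffsIn_monoMap {S : Subring Coeff} {f : QSeries w}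
    (hf : HasCoeffsIn (S : Set Coeff) f) : HasCoeffsIn (S : Set Coeff) (monoMap w' y f) := by
  rw [hasCoeffsIn_iff] at hf ⊢
  have hword (l : List ι) : monoMap w' y (word l : QSeries w) =
      word (l.flatMap fun i => (Finsupp.toMultiset (y i)).sort (· ≤ ·)) := by
    rw [← hy.toRingHom_apply]
    induction l with
    | nil => simp [word, map_one]
    | cons a l ih =>
      rw [List.flatMap_cons, word_append, ← ih, ← mono_eq_word, ← hy.monoMap_X,
        ← hy.toRingHom_apply, ← map_mul]
      simp [word]
  intro M
  rw [hy.coeff_monoMap]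
  refine sum_mem fun n hn => ?_
  have hn : expMap y n = M := by simpa using hn
  have key : ∀ t ∈ wordSpan w S n, qpow (monoExp w' y n) * t ∈ wordSpan w' S M := by
    intro t ht
    induction ht using AddSubgroup.closure_induction with
    | zero => simp
    | add x y _ _ hx hy => rw [mul_add]; exact add_mem hx hy
    | neg x _ hx =>
      rw [show ∀ u v : Coeff, u * -v = -(u * v) from fun u v => by ring]
      exact neg_mem hx
    | mem t h =>
      obtain ⟨s, hs, l, rfl⟩ := h
      by_cases hl : content l = n
      · have h := mul_coeff_word_mem (w := w') hs
          (l.flatMap fun i => (Finsupp.toMultiset (y i)).sort (· ≤ ·)) M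
        rw [← hword, word_eq_coeff_smul, hl, hy.monoMap_smul, hy.monoMap_mono, hn, coeff_smul,
          coeff_smul, coeff_mono_self] at h
        convert h using 1
        ring
      · simp [coeff_word_ne hl]
  exact key _ (hf n)

end IsMonoMap

end QSeries

/-! ### The variables of a MOY graph -/

theorem Slot.sum_eq {M : Type*} [AddCommMonoid M] (f : Slot → M) :
    ∑ s, f s = f .l + f .m + f .r := by
  change ∑ s ∈ {Slot.l, Slot.m, Slot.r}, f s = _
  rw [Finset.sum_insert (by decide), Finset.sum_insert (by decide), Finset.sum_singleton, add_assoc]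

theorem EdgeEnd.sum_eq {M : Type*} [AddCommMonoid M] (f : EdgeEnd → M) :
    ∑ s, f s = f .tail + f .head := by
  change ∑ s ∈ {EdgeEnd.tail, EdgeEnd.head}, f s = _
  rw [Finset.sum_insert (by decide), Finset.sum_singleton]

namespace MOYGraph

open QSeries

variable (Γ : MOYGraph)

/-- The exponents of the monomial `z^γ Z^γ`. -/
def hExp (γ : Γ.Edge → ℕ) : Γ.HVar →₀ ℕ :=
  Finsupp.equivFunOnFinite.symm fun
    | .z h => γ (Γ.edgeOf h)
    | .Z h => γ (Γ.edgeOf h)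

theorem zZ_eq_mono (γ : Γ.Edge → ℕ) : Γ.zZ γ = mono (Γ.hExp γ) := rfl

@[simp] theorem hExp_z (γ : Γ.Edge → ℕ) (h) : Γ.hExp γ (.z h) = γ (Γ.edgeOf h) := rfl

@[simp] theorem hExp_Z (γ : Γ.Edge → ℕ) (h) : Γ.hExp γ (.Z h) = γ (Γ.edgeOf h) := rfl

theorem edgeOf_surjective : Function.Surjective Γ.edgeOf := by
  rintro (e | o)
  · exact ⟨.inl (Γ.glue (e, .tail)), by simp [edgeOf, flagEdge]⟩
  · exact ⟨.inr o, rfl⟩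

theorem hExp_injective : Function.Injective Γ.hExp := by
  intro γ γ' h
  funext e
  obtain ⟨t, rfl⟩ := Γ.edgeOf_surjective e
  exact DFunLike.congr_fun h (HVar.z t)

/-- `hExp` as an additive map. -/
def hExpHom : (Γ.Edge → ℕ) →+ (Γ.HVar →₀ ℕ) where
  toFun := Γ.hExp
  map_zero' := by ext (h | h) <;> rfl
  map_add' γ γ' := by ext (h | h) <;> rfl

theorem hExp_sum {σ : Type*} (s : Finset σ) (γ : σ → Γ.Edge → ℕ) :
    Γ.hExp (∑ i ∈ s, γ i) = ∑ i ∈ s, Γ.hExp (γ i) := map_sum Γ.hExpHom _ _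

theorem hExp_smul (n : ℕ) (γ : Γ.Edge → ℕ) : Γ.hExp (n • γ) = n • Γ.hExp γ :=
  map_nsmul Γ.hExpHom n γ

theorem sum_hVar (f : Γ.HVar → ℤ) : ∑ i, f i =
    ((∑ v, ∑ s, f (.z (.inl (v, s)))) + ∑ o, f (.z (.inr o))) +
      ((∑ v, ∑ s, f (.Z (.inl (v, s)))) + ∑ o, f (.Z (.inr o))) := by
  let e : Γ.HalfEdge ⊕ Γ.HalfEdge ≃ Γ.HVar :=
    { toFun := Sum.elim HVar.z HVar.Z
      invFun := fun | .z h => .inl h | .Z h => .inr h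
      left_inv := by rintro (h | h) <;> rfl
      right_inv := by rintro (h | h) <;> rfl }
  rw [← e.sum_comp, Fintype.sum_sum_type, Fintype.sum_sum_type, Fintype.sum_sum_type,
    Fintype.sum_prod_type, Fintype.sum_prod_type]
  rfl

/-- Reordering the product of `z^γ Z^γ` and `z^γ' Z^γ'`: only the left and right flags at the same
vertex do not commute, and the orders of the `z` and of the `Z` are opposite to each other. -/
theorem reorder_hExp (γ γ' : Γ.Edge → ℕ) : reorder hComm (Γ.hExp γ) (Γ.hExp γ') =
    ∑ v, ((γ (Γ.flagEdge v .l) : ℤ) * γ' (Γ.flagEdge v .r) -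
      (γ (Γ.flagEdge v .r) : ℤ) * γ' (Γ.flagEdge v .l)) := by
  have hlt (a b : Γ.HVar) : a < b ↔ a.place < b.place := Iff.rfl
  -- The inner sums: each of `z_r` and `Z_l` passes exactly one variable that it does not commute with.
  have hzr (v : Fin Γ.nV) : (∑ j, if j < HVar.z (.inl (v, .r)) then
      hComm (.z (.inl (v, .r))) j * (Γ.hExp γ (.z (.inl (v, .r))) : ℤ) * (Γ.hExp γ' j : ℤ) else 0) =
      -((γ (Γ.flagEdge v .r) : ℤ) * (γ' (Γ.flagEdge v .l) : ℤ)) := by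
    rw [Finset.sum_eq_single (.z (.inl (v, .l)))]
    · simp [hlt, HVar.place, hComm, edgeOf]
    · rintro ((⟨v', _ | _ | _⟩ | o) | (⟨v', _ | _ | _⟩ | o)) - hne
      · have : v ≠ v' := fun h => hne (by rw [h])
        simp [hComm, this]
      all_goals simp [hComm]
    · simp
  have hZl (v : Fin Γ.nV) : (∑ j, if j < HVar.Z (.inl (v, .l)) then
      hComm (.Z (.inl (v, .l))) j * (Γ.hExp γ (.Z (.inl (v, .l))) : ℤ) * (Γ.hExp γ' j : ℤ) else 0) =
      (γ (Γ.flagEdge v .l) : ℤ) * (γ' (Γ.flagEdge v .r) : ℤ) := by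
    rw [Finset.sum_eq_single (.Z (.inl (v, .r)))]
    · simp [hlt, HVar.place, hComm, edgeOf]
    · rintro ((⟨v', _ | _ | _⟩ | o) | (⟨v', _ | _ | _⟩ | o)) - hne
      on_goal 7 =>
        have : v ≠ v' := fun h => hne (by rw [h])
        simp [hComm, this]
      all_goals simp [hComm]
    · simp
  have h0 (i : Γ.HVar) (hi : ∀ v, i ≠ .z (.inl (v, .r)) ∧ i ≠ .Z (.inl (v, .l))) :
      (∑ j, if j < i then hComm i j * (Γ.hExp γ i : ℤ) * (Γ.hExp γ' j : ℤ) else 0) = 0 := by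
    refine Finset.sum_eq_zero fun j _ => ?_
    by_cases h : j < i
    · have : hComm i j = 0 := by
        rcases i with (⟨v, _ | _ | _⟩ | o) | (⟨v, _ | _ | _⟩ | o)
        case z.inl.r => exact absurd rfl (hi v).1
        case Z.inl.l => exact absurd rfl (hi v).2
        all_goals
          rcases j with (⟨v', _ | _ | _⟩ | o') | (⟨v', _ | _ | _⟩ | o')
          all_goals
            simp only [hComm, ite_eq_right_iff]
            try rintro rfl; simp [hlt, HVar.place] at h
      simp [this]
    · simp [h]
  rw [reorder, sum_hVar]
  simp only [Slot.sum_eq, hzr, hZl, fun v => h0 (.z (.inl (v, .l))) (by simp),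
    fun v => h0 (.z (.inl (v, .m))) (by simp), fun v => h0 (.Z (.inl (v, .r))) (by simp),
    fun v => h0 (.Z (.inl (v, .m))) (by simp), fun o => h0 (.z (.inr o)) (by simp),
    fun o => h0 (.Z (.inr o)) (by simp)]
  simp only [zero_add, add_zero, Finset.sum_const_zero, ← Finset.sum_add_distrib]
  exact Finset.sum_congr rfl fun v _ => by ring

/-! ### Flows and cycles -/

theorem sum_inSlots_eq_iff (γ : Γ.Edge → ℕ) (v : Fin Γ.nV) :
    (∑ s ∈ Γ.inSlots v, γ (Γ.flagEdge v s) = ∑ s ∈ Γ.outSlots v, γ (Γ.flagEdge v s)) ↔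
      γ (Γ.flagEdge v .m) = γ (Γ.flagEdge v .l) + γ (Γ.flagEdge v .r) := by
  simp only [inSlots, outSlots, Finset.sum_filter, Slot.sum_eq, ← Γ.dir_lr v]
  have h := Γ.dir_lm v
  cases hl : (Γ.glue.symm (v, .l)).2 <;> cases hm : (Γ.glue.symm (v, .m)).2
  · exact absurd (hl.trans hm.symm) h
  · simp
  · simp [eq_comm]
  · exact absurd (hl.trans hm.symm) h

/-- At each vertex the middle edge carries as much as the other two together. -/
def IsFlow (γ : Γ.Edge → ℕ) : Prop :=
  ∀ v, γ (Γ.flagEdge v .m) = γ (Γ.flagEdge v .l) + γ (Γ.flagEdge v .r)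

/-- Two flows `γ`, `γ'` exchange left and right flags an even number of times: modulo `2` the number is
the sum of `γ γ'` over all flags, and each edge has two flags. -/
theorem even_reorder_hExp {γ γ' : Γ.Edge → ℕ} (h : Γ.IsFlow γ) (h' : Γ.IsFlow γ') :
    Even (reorder hComm (Γ.hExp γ) (Γ.hExp γ')) := by
  have h1 : ∑ f : Fin Γ.nV × Slot, (γ (Γ.flagEdge f.1 f.2) : ℤ) * γ' (Γ.flagEdge f.1 f.2) =
      ∑ e : Fin Γ.nE, 2 * ((γ (.inl e) : ℤ) * γ' (.inl e)) := by
    rw [← Γ.glue.sum_comp, Fintype.sum_prod_type]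
    refine Finset.sum_congr rfl fun e _ => ?_
    rw [EdgeEnd.sum_eq]
    simp [flagEdge, two_mul]
  have h2 : reorder hComm (Γ.hExp γ) (Γ.hExp γ') =
      ∑ f : Fin Γ.nV × Slot, (γ (Γ.flagEdge f.1 f.2) : ℤ) * γ' (Γ.flagEdge f.1 f.2) -
      2 * ∑ v, ((γ (Γ.flagEdge v .l) : ℤ) * γ' (Γ.flagEdge v .l) +
        (γ (Γ.flagEdge v .r) : ℤ) * γ' (Γ.flagEdge v .r) +
        (γ (Γ.flagEdge v .r) : ℤ) * γ' (Γ.flagEdge v .l)) := by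
    rw [reorder_hExp, Fintype.sum_prod_type, Finset.mul_sum, ← Finset.sum_sub_distrib]
    refine Finset.sum_congr rfl fun v _ => ?_
    rw [Slot.sum_eq, h v, h' v]
    push_cast
    ring
  rw [h2, h1, ← Finset.mul_sum]
  exact (even_two_mul _).sub (even_two_mul _)

/-- The indicator function of a set of edges. -/
def ind (C : Finset Γ.Edge) : Γ.Edge → ℕ := fun e => if e ∈ C then 1 else 0

theorem muX_eq_mono (C : Γ.Cycle) : Γ.muX C = mono (Γ.hExp (Γ.ind C.1)) := rfl

theorem isFlow_ind (C : Γ.Cycle) : Γ.IsFlow (Γ.ind C.1) := by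
  intro v
  rw [← sum_inSlots_eq_iff]
  simp only [ind, ← Finset.card_filter]
  rcases C.2 v with h | h <;> rw [h.1, h.2]

theorem isFlow_sum {σ : Type*} (s : Finset σ) (γ : σ → Γ.Edge → ℕ) (h : ∀ i ∈ s, Γ.IsFlow (γ i)) :
    Γ.IsFlow (∑ i ∈ s, γ i) := by
  intro v
  simp only [Finset.sum_apply, ← Finset.sum_add_distrib]
  exact Finset.sum_congr rfl fun i hi => h i hi v

/-- The commutation exponents of the variables `x_C`. -/
abbrev xComm (C C' : Γ.NCycle) : ℤ := cycleComm C.1 C'.1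

/-- The exponents of `μ(x_C)`. -/
def cycleExp (C : Γ.NCycle) : Γ.HVar →₀ ℕ := Γ.hExp (Γ.ind C.1.1)

theorem cycleComm_eq (C C' : Γ.Cycle) :
    cycleComm C C' = 2 * reorder hComm (Γ.hExp (Γ.ind C.1)) (Γ.hExp (Γ.ind C'.1)) := by
  rw [cycleComm, reorder_hExp, Finset.sum_sub_distrib, Finset.card_filter, Finset.card_filter]
  push_cast
  simp only [ind, ite_and]
  congr 2 <;> refine Finset.sum_congr rfl fun v _ => ?_ <;> split_ifs <;> rfl

theorem isMonoMap_cycleExp :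
    IsMonoMap Γ.xComm hComm Γ.cycleExp where
  ne_zero C h := by
    obtain ⟨e, he⟩ := C.2
    obtain ⟨t, rfl⟩ := Γ.edgeOf_surjective e
    have := DFunLike.congr_fun h (HVar.z t)
    simp [cycleExp, ind, he] at this
  alt C C' := by
    rw [cycleExp, cycleExp, reorder_hExp, reorder_hExp, ← Finset.sum_neg_distrib]
    exact Finset.sum_congr rfl fun v _ => by ring
  comm C C' := Γ.cycleComm_eq C.1 C'.1

theorem mu_eq_monoMap (f : Γ.XSeries) : Γ.mu f = monoMap hComm Γ.cycleExp f := rfl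

theorem expMap_cycleExp (n : Γ.NCycle →₀ ℕ) :
    expMap Γ.cycleExp n = Γ.hExp (∑ C, n C • Γ.ind C.1.1) := by
  rw [hExp_sum, expMap]
  exact Finset.sum_congr rfl fun C _ => (Γ.hExp_smul _ _).symm

theorem isFlow_sum_smul_ind (n : Γ.NCycle →₀ ℕ) : Γ.IsFlow (∑ C, n C • Γ.ind C.1.1) := by
  refine Γ.isFlow_sum _ _ fun C _ v => ?_
  have := Γ.isFlow_ind C.1 v
  simp only [Pi.smul_apply, smul_eq_mul, this, mul_add]

/-! ### The cycle polynomial -/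

/-- The degree of the variable `x_C`. -/
def deg (C : Γ.NCycle) : ℤ := Γ.rot C.1

theorem rot_emptyCycle : Γ.rot Γ.emptyCycle = 0 := by
  simp [rot, components, emptyCycle]

theorem ne_emptyCycle_iff (C : Γ.Cycle) : C ≠ Γ.emptyCycle ↔ C.1.Nonempty := by
  rw [Finset.nonempty_iff_ne_empty, ne_eq, ne_eq, not_iff_not]
  exact Subtype.ext_iff

theorem sum_cycle {M : Type*} [AddCommMonoid M] (f : Γ.Cycle → M) :
    ∑ C, f C = f Γ.emptyCycle + ∑ C : Γ.NCycle, f C.1 := by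
  classical
  rw [← Finset.add_sum_erase _ f (Finset.mem_univ Γ.emptyCycle)]
  congr 1
  exact Finset.sum_subtype (p := fun C : Γ.Cycle => C.1.Nonempty) _
    (fun C => by rw [← ne_emptyCycle_iff]; simp) f

theorem scale_linSeries (u : Coeffˣ) :
    scale Γ.deg u (linSeries Γ.xComm) =
      ∑ C, ((u ^ Γ.rot C : Coeffˣ) : Coeff) • Γ.x C := by
  have hX (C : Γ.NCycle) : scale Γ.deg u (X C : Γ.XSeries) =
      ((u ^ Γ.rot C.1 : Coeffˣ) : Coeff) • X C := by
    ext m : 1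
    rw [coeff_scale, coeff_smul, X]
    by_cases h : m = Finsupp.single C 1
    · rw [h, wdeg_single, deg]
    · rw [coeff_mono_ne h, mul_zero, mul_zero]
  have hx (C : Γ.NCycle) : Γ.x C.1 = X C := by
    rw [x, dif_pos C.2]
    rfl
  rw [sum_cycle, rot_emptyCycle, linSeries, map_add, map_one, map_sum]
  congr 1
  · simp [x, emptyCycle]
  · exact Finset.sum_congr rfl fun C _ => by rw [hX, hx]

theorem cyclePoly_eq_scale (Q A : Coeffˣ) : Γ.cyclePoly Q A Γ.x =
    scale Γ.deg (A⁻¹ * Q) (linSeries Γ.xComm) :=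
  (Γ.scale_linSeries _).symm

/-- The finite products depend on `a` only through a rescaling of the variables. -/
theorem poch_eq_scale (A : Coeffˣ) (n : ℕ) : Γ.poch qHalf A n =
    scale Γ.deg (A⁻¹ * qHalf) (linProd Γ.xComm Γ.deg n) := by
  -- In `poch` the index `k` is an integer, so that `List.range n` is coerced there entry by entry.
  have hr : (do let k ← List.range n; pure (k : ℤ)) = (List.range n).map fun k : ℕ => (k : ℤ) :=
    bind_pure_comp _ _
  rw [poch, hr, List.map_map, linProd, map_list_prod, List.map_map]
  congr 1
  refine List.map_congr_left fun k _ => ?_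
  rw [Function.comp_apply, Function.comp_apply, scale_scale, scale_linSeries, cyclePoly]
  refine Finset.sum_congr rfl fun C _ => ?_
  have h : (A⁻¹ * qHalf * (qHalf ^ 2) ^ k) ^ Γ.rot C =
      (A⁻¹ * qHalf) ^ Γ.rot C * (qHalf ^ 2) ^ ((k : ℤ) * Γ.rot C) := by
    rw [zpow_mul, zpow_natCast]
    exact mul_zpow (A⁻¹ * qHalf) _ _
  rw [smul_smul, h, Units.val_mul]

end MOYGraph

/-! ### Expansion of finite products over states -/

namespace QSeries

variable {ι : Type} {w : ι → ι → ℤ} [Fintype ι] [LinearOrder ι]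

theorem prod_map_qpow_smul_mono {σ : Type} (α : σ → ℤ) (y : σ → ι →₀ ℕ) (l : List σ) :
    (l.map fun i => qpow (α i) • (mono (y i) : QSeries w)).prod =
      qpow ((l.map α).sum + pairSum (fun i j => reorder w (y i) (y j)) l) •
        mono (l.map y).sum := by
  induction l with
  | nil => simp [pairSum, one_eq_mono]
  | cons a l ih =>
    rw [List.map_cons, List.prod_cons, ih, smul_mul_smul_comm, mono_mul_mono, smul_smul,
      ← qpow_add, ← qpow_add, List.map_cons, List.map_cons, List.sum_cons, List.sum_cons, pairSum,
      reorder_sum_right]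
    congr 2
    ring

theorem pairSum_map {σ τ : Type} (b : τ → τ → ℤ) (f : σ → τ) (l : List σ) :
    pairSum b (l.map f) = pairSum (fun i j => b (f i) (f j)) l := by
  induction l with
  | nil => rfl
  | cons a l ih => simp [pairSum, ih, Function.comp_def]

theorem pairSum_finRange {n : ℕ} (b : Fin n → Fin n → ℤ) :
    pairSum b (List.finRange n) = ∑ i, ∑ j, if i < j then b i j else 0 := by
  induction n with
  | zero => simp [pairSum]
  | succ n ih =>
    rw [List.finRange_succ, pairSum, pairSum_map, ih, Fin.sum_univ_succ, List.map_map]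
    congr 1
    · rw [Fin.sum_univ_succ, if_neg (lt_irrefl _), zero_add]
      simp only [Fin.succ_pos, if_true]
      rw [← List.sum_ofFn, List.ofFn_eq_map]
      rfl
    · exact Finset.sum_congr rfl fun i _ => by rw [Fin.sum_univ_succ]; simp

end QSeries

/-- The distributive law for an ordered product of sums in a noncommutative ring. -/
theorem prod_map_range_sum {R σ : Type*} [Semiring R] [Fintype σ] (F : ℕ → σ → R) (n : ℕ) :
    ((List.range n).map fun k => ∑ c, F k c).prod =
      ∑ f : Fin n → σ, ((List.finRange n).map fun k : Fin n => F k (f k)).prod := by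
  induction n with
  | zero => simp
  | succ n ih =>
    rw [List.range_succ, List.map_append, List.prod_append, ih,
      ← (Fin.snocEquiv fun _ : Fin (n + 1) => σ).sum_comp, Fintype.sum_prod_type_right,
      Finset.sum_mul]
    refine Finset.sum_congr rfl fun f _ => ?_
    simp only [List.map_cons, List.map_nil, List.prod_cons, List.prod_nil, mul_one, Finset.mul_sum]
    refine Finset.sum_congr rfl fun c _ => ?_
    rw [List.finRange_succ_last, List.map_append, List.prod_append, List.map_map]
    simp [Fin.snocEquiv, Function.comp_def]

namespace MOYGraph

open QSeries

variable {Γ : MOYGraph}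

/-- Twice the `k`-th element of `A_N`, in increasing order. -/
def label (N : ℕ) (k : Fin N) : ℤ := 2 * (k : ℤ) - ((N : ℤ) - 1)

theorem label_lt_label {N : ℕ} {k k' : Fin N} : label N k < label N k' ↔ k < k' := by
  simp only [label, Fin.lt_def]
  omega

theorem label_injective (N : ℕ) : Function.Injective (label N) := by
  intro k k' h
  ext
  simp only [label] at h
  lia

theorem mem_labels {N : ℕ} {x : ℤ} : x ∈ labels N ↔ ∃ k : Fin N, label N k = x := by
  simp only [labels, Finset.mem_image, Finset.mem_range, label]
  constructor
  · rintro ⟨k, hk, rfl⟩; exact ⟨⟨k, hk⟩, rfl⟩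
  · rintro ⟨k, rfl⟩; exact ⟨k, k.2, rfl⟩

/-- The state that corresponds to a choice of a cycle for each label: the label `k` belongs to the
set of the cycle `f k`, or to no set at all if `f k` is empty. -/
def stateOf {N : ℕ} (f : Fin N → Γ.Cycle) (C : Γ.Cycle) : Finset ℤ := by
  classical
  exact if C = Γ.emptyCycle then ∅ else (Finset.univ.filter fun k => f k = C).image (label N)

theorem mem_stateOf {N : ℕ} (f : Fin N → Γ.Cycle) (C : Γ.Cycle) (x : ℤ) :
    x ∈ stateOf f C ↔ C ≠ Γ.emptyCycle ∧ ∃ k, f k = C ∧ label N k = x := by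
  classical
  rw [stateOf]
  split_ifs with h <;> simp [h]

theorem stateOf_mem_states {N : ℕ} (f : Fin N → Γ.Cycle) : stateOf f ∈ Γ.states N := by
  classical
  simp only [states, Finset.mem_filter, Fintype.mem_piFinset, Finset.mem_powerset]
  refine ⟨fun C x hx => ?_, ?_, fun C C' h => ?_⟩
  · obtain ⟨-, k, -, hk⟩ := (mem_stateOf f C x).1 hx
    exact mem_labels.2 ⟨k, hk⟩
  · simp [stateOf]
  · rw [Finset.disjoint_left]
    intro x hx hx'
    obtain ⟨-, k, hk, rfl⟩ := (mem_stateOf f C x).1 hx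
    obtain ⟨-, k', hk', hl⟩ := (mem_stateOf f C' _).1 hx'
    rw [label_injective N hl] at hk'
    exact h (hk.symm.trans hk')

theorem stateOf_injective {N : ℕ} : Function.Injective (stateOf (Γ := Γ) (N := N)) := by
  have key (f g : Fin N → Γ.Cycle) (h : stateOf f = stateOf g) (k) (hk : f k ≠ Γ.emptyCycle) :
      f k = g k := by
    have h1 : label N k ∈ stateOf g (f k) := h ▸ (mem_stateOf f _ _).2 ⟨hk, k, rfl, rfl⟩
    obtain ⟨-, k', hk', hl⟩ := (mem_stateOf g _ _).1 h1
    rw [← hk', label_injective N hl]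
  intro f g h
  funext k
  by_cases hf : f k = Γ.emptyCycle
  · by_cases hg : g k = Γ.emptyCycle
    · rw [hf, hg]
    · exact (key g f h.symm k hg).symm
  · exact key f g h k hf

/-- Every state comes from a choice of a cycle for each label, as its sets are disjoint; labels in none
of the sets are assigned the empty cycle. -/
theorem exists_stateOf_eq {N : ℕ} {σ : Γ.Cycle → Finset ℤ} (hσ : σ ∈ Γ.states N) :
    ∃ f : Fin N → Γ.Cycle, stateOf f = σ := by
  classical
  simp only [states, Finset.mem_filter, Fintype.mem_piFinset, Finset.mem_powerset] at hσ
  obtain ⟨h1, h2, h3⟩ := hσ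
  refine ⟨fun k => if h : ∃ C, label N k ∈ σ C then h.choose else Γ.emptyCycle, ?_⟩
  funext C
  ext x
  rw [mem_stateOf]
  constructor
  · rintro ⟨hC, k, hk, rfl⟩
    split_ifs at hk with h
    · exact hk ▸ h.choose_spec
    · exact absurd hk.symm hC
  · intro hx
    refine ⟨?_, ?_⟩
    · rintro rfl
      simp [h2] at hx
    · obtain ⟨k, rfl⟩ := mem_labels.1 (h1 C hx)
      have h : ∃ C, label N k ∈ σ C := ⟨C, hx⟩
      refine ⟨k, ?_, rfl⟩
      rw [dif_pos h]
      by_contra hne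
      exact Finset.disjoint_left.1 (h3 _ _ hne) h.choose_spec hx

theorem edgeLabels_stateOf {N : ℕ} (f : Fin N → Γ.Cycle) (e : Γ.Edge) :
    edgeLabels (stateOf f) e = (Finset.univ.filter fun k => e ∈ (f k).1).image (label N) := by
  ext x
  simp only [edgeLabels, Finset.mem_biUnion, Finset.mem_filter, Finset.mem_univ, true_and,
    mem_stateOf, Finset.mem_image]
  constructor
  · rintro ⟨C, he, -, k, rfl, rfl⟩
    exact ⟨k, he, rfl⟩
  · rintro ⟨k, he, rfl⟩
    exact ⟨f k, he, (Γ.ne_emptyCycle_iff _).2 ⟨e, he⟩, k, rfl, rfl⟩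

theorem card_edgeLabels_stateOf {N : ℕ} (f : Fin N → Γ.Cycle) (e : Γ.Edge) :
    (edgeLabels (stateOf f) e).card = (∑ k, Γ.ind (f k).1) e := by
  rw [edgeLabels_stateOf, Finset.card_image_of_injective _ (label_injective N), Finset.card_filter,
    Finset.sum_apply]
  rfl

theorem twiceRot_stateOf {N : ℕ} (f : Fin N → Γ.Cycle) :
    twiceRot (stateOf f) = ∑ k, Γ.rot (f k) * label N k := by
  classical
  rw [← Finset.sum_fiberwise Finset.univ f, twiceRot]
  refine Finset.sum_congr rfl fun C _ => ?_
  by_cases h : C = Γ.emptyCycle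
  · rw [h, rot_emptyCycle, zero_mul, Finset.sum_eq_zero]
    intro k hk
    rw [(Finset.mem_filter.1 hk).2, rot_emptyCycle, zero_mul]
  · rw [stateOf, if_neg h, Finset.sum_image fun _ _ _ _ h => label_injective N h, Finset.mul_sum]
    refine Finset.sum_congr rfl fun k hk => ?_
    rw [(Finset.mem_filter.1 hk).2]

theorem card_filter_image_product {N : ℕ} (s t : Finset (Fin N)) (r : ℤ → ℤ → Prop)
    (r' : Fin N → Fin N → Prop) [DecidableRel r] [DecidableRel r']
    (h : ∀ i j, r (label N i) (label N j) ↔ r' i j) :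
    (((s.image (label N) ×ˢ t.image (label N)).filter fun p => r p.1 p.2).card : ℤ) =
      ∑ i, ∑ j, if r' i j then (if i ∈ s then 1 else 0) * (if j ∈ t then 1 else 0) else 0 := by
  have h1 : (s.image (label N) ×ˢ t.image (label N)).filter (fun p => r p.1 p.2) =
      ((s ×ˢ t).filter fun p => r' p.1 p.2).image (Prod.map (label N) (label N)) := by
    ext ⟨a, b⟩
    simp only [Finset.mem_filter, Finset.mem_product, Finset.mem_image, Prod.exists, Prod.map_apply,
      Prod.mk.injEq]
    constructor
    · rintro ⟨⟨⟨i, hi, rfl⟩, ⟨j, hj, rfl⟩⟩, hr⟩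
      exact ⟨i, j, ⟨⟨hi, hj⟩, (h i j).1 hr⟩, rfl, rfl⟩
    · rintro ⟨i, j, ⟨⟨hi, hj⟩, hr⟩, rfl, rfl⟩
      exact ⟨⟨⟨i, hi, rfl⟩, ⟨j, hj, rfl⟩⟩, (h i j).2 hr⟩
  rw [h1, Finset.card_image_of_injective _ ((label_injective N).prodMap (label_injective N)),
    Finset.card_filter, ← Fintype.sum_prod_type']
  push_cast
  rw [← Finset.sum_filter_add_sum_filter_not Finset.univ (fun p : Fin N × Fin N => p ∈ s ×ˢ t)]
  rw [Finset.sum_eq_zero (s := Finset.univ.filter fun p : Fin N × Fin N => p ∉ s ×ˢ t), add_zero]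
  · refine Finset.sum_congr (by ext; simp) fun p hp => ?_
    obtain ⟨hi, hj⟩ := Finset.mem_product.1 (Finset.mem_filter.1 hp).2
    simp [hi, hj]
  · intro p hp
    have := (Finset.mem_filter.1 hp).2
    rw [Finset.mem_product, not_and_or] at this
    rcases this with h | h <;> simp [h]

/-- The total exponent of the vertex weights of a state is the number of exchanges needed to reorder
the product of the monomials of its cycles, taken in increasing order of their labels. -/
theorem sum_numR_sub_numL {N : ℕ} (f : Fin N → Γ.Cycle) :
    ∑ v, ((numR v (stateOf f) : ℤ) - (numL v (stateOf f) : ℤ)) =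
      ∑ i, ∑ j, if i < j then
        reorder hComm (Γ.hExp (Γ.ind (f i).1)) (Γ.hExp (Γ.ind (f j).1)) else 0 := by
  have h1 (v : Fin Γ.nV) : ((numR v (stateOf f) : ℤ) - (numL v (stateOf f) : ℤ)) =
      ∑ i, ∑ j, if i < j then
        ((Γ.ind (f i).1 (Γ.flagEdge v .l) : ℤ) * Γ.ind (f j).1 (Γ.flagEdge v .r) -
        (Γ.ind (f i).1 (Γ.flagEdge v .r) : ℤ) * Γ.ind (f j).1 (Γ.flagEdge v .l)) else 0 := by
    rw [numR, numL, edgeLabels_stateOf, edgeLabels_stateOf,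
      card_filter_image_product _ _ (· < ·) (· < ·) fun _ _ => label_lt_label,
      card_filter_image_product _ _ (· > ·) (· > ·) fun _ _ => label_lt_label,
      Finset.sum_comm (f := fun i j => if i > j then _ else _), ← Finset.sum_sub_distrib]
    refine Finset.sum_congr rfl fun i _ => ?_
    rw [← Finset.sum_sub_distrib]
    refine Finset.sum_congr rfl fun j _ => ?_
    by_cases h : i < j
    · simp [h, ind, mul_comm]
    · simp [h]
  simp only [h1, reorder_hExp]
  rw [Finset.sum_comm]
  refine Finset.sum_congr rfl fun i _ => ?_
  rw [Finset.sum_comm]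
  refine Finset.sum_congr rfl fun j _ => ?_
  split_ifs <;> simp

theorem prod_wt_stateOf {N : ℕ} (f : Fin N → Γ.Cycle) :
    ∏ v, Γ.wt v (stateOf f) = qQuarter ^ (∑ i, ∑ j, if i < j then
        reorder hComm (Γ.hExp (Γ.ind (f i).1)) (Γ.hExp (Γ.ind (f j).1)) else 0) := by
  rw [← sum_numR_sub_numL]
  generalize (Finset.univ : Finset (Fin Γ.nV)) = s
  classical
  induction s using Finset.induction_on with
  | empty => simp
  | insert v s hv ih => rw [Finset.prod_insert hv, Finset.sum_insert hv, zpow_add, ← ih, wt]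

theorem C_coe_qQuarter_zpow (k : ℤ) :
    LaurentPolynomial.C ((qQuarter ^ k : QLaurentˣ) : QLaurent) = qpow k := by
  rw [Coeff.coe_qQuarter_zpow, Coeff.qpow_eq_C]

/-- The evaluations `⟨Γ, γ⟩_N` are the coefficients of an ordered product of `N` factors, one for each
label. -/
theorem coeff_prod_eq_evalN (γ : Γ.Flow) (N : ℕ) :
    ((List.range N).map fun k : ℕ => ∑ C, qpow (2 * (2 * (k : ℤ) - ((N : ℤ) - 1)) * Γ.rot C) •
      Γ.muX C).prod.coeff (Γ.hExp γ.1) = LaurentPolynomial.C (Γ.evalN γ N) := by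
  classical
  rw [prod_map_range_sum, coeff_sum]
  simp only [muX_eq_mono, prod_map_qpow_smul_mono, coeff_smul, pairSum_finRange]
  rw [evalN, map_sum, Finset.sum_filter]
  symm
  refine (Finset.sum_bij (fun f _ => stateOf f) (fun f _ => stateOf_mem_states f)
    (fun f _ g _ h => stateOf_injective h) (fun σ hσ => ?_) fun f _ => ?_).symm
  · obtain ⟨f, hf⟩ := exists_stateOf_eq hσ
    exact ⟨f, Finset.mem_univ _, hf⟩
  · have hsum : ((List.finRange N).map fun k => Γ.hExp (Γ.ind (f k).1)).sum =
        Γ.hExp (∑ k, Γ.ind (f k).1) := by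
      rw [hExp_sum, ← List.ofFn_eq_map, List.sum_ofFn]
    have hiff : (∀ e, (edgeLabels (stateOf f) e).card = γ.1 e) ↔
        ∑ k, Γ.ind (f k).1 = γ.1 := by
      simp only [card_edgeLabels_stateOf, funext_iff]
    rw [hsum]
    simp only [hiff]
    split_ifs with h
    · rw [h, coeff_mono_self, mul_one, prod_wt_stateOf, ← zpow_add, C_coe_qQuarter_zpow,
        twiceRot_stateOf, ← List.ofFn_eq_map, List.sum_ofFn, Finset.mul_sum]
      congr 2
      exact Finset.sum_congr rfl fun k _ => by rw [label]; ring
    · rw [coeff_mono_ne fun h' => h (Γ.hExp_injective h'.symm), mul_zero]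

end MOYGraph

/-! ### The generating series -/

namespace MOYGraph

open QSeries

variable {Γ : MOYGraph} (hΓ : Γ.Positive)

include hΓ in
theorem deg_pos (C : Γ.NCycle) : 0 < Γ.deg C := hΓ C.1 C.2

/-- The infinite product `∏_{k ≥ 0} ∑_C q^{k rot C} x_C`. -/
def cycleProd : Γ.XSeries := linProdInf _ (deg_pos hΓ)

theorem exists_cycleProdInv : ∃ G : Γ.XSeries,
    G.coeff 0 = 1 ∧ cycleProd hΓ * G = 1 ∧ G * cycleProd hΓ = 1 :=
  exists_inv _ (coeff_linProdInf_zero (deg_pos hΓ))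

/-- The inverse of `cycleProd`. -/
def cycleProdInv : Γ.XSeries := Classical.choose (exists_cycleProdInv hΓ)

theorem cycleProd_mul_inv : cycleProd hΓ * cycleProdInv hΓ = 1 :=
  (Classical.choose_spec (exists_cycleProdInv hΓ)).2.1

theorem cycleProdInv_mul : cycleProdInv hΓ * cycleProd hΓ = 1 :=
  (Classical.choose_spec (exists_cycleProdInv hΓ)).2.2

theorem hasLimit_poch (A : Coeffˣ) :
    HasLimit (Γ.poch qHalf A) (scale Γ.deg (A⁻¹ * qHalf) (cycleProd hΓ)) := by
  have h := hasLimit_scale_linProd (w := Γ.xComm) (deg_pos hΓ)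
    (A⁻¹ * qHalf)
  simp only [← poch_eq_scale] at h
  exact h

include hΓ in
theorem hasLimit_pochInf (A : Coeffˣ) : HasLimit (Γ.poch qHalf A) (Γ.pochInf qHalf A) :=
  Classical.epsilon_spec (p := HasLimit (Γ.poch qHalf A)) ⟨_, hasLimit_poch hΓ A⟩

theorem pochInf_eq (A : Coeffˣ) :
    Γ.pochInf qHalf A = scale Γ.deg (A⁻¹ * qHalf) (cycleProd hΓ) :=
  (hasLimit_pochInf hΓ A).unique (hasLimit_poch hΓ A)

/-- The quotient of the two infinite products; its image under `μ` is the generating series. -/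
def quotSeries : Γ.XSeries :=
  scale Γ.deg (aHalf⁻¹ * qHalf) (cycleProd hΓ) * scale Γ.deg (aHalf * qHalf) (cycleProdInv hΓ)

theorem quotSeries_mul_pochInf :
    quotSeries hΓ * Γ.pochInf qHalf aHalf⁻¹ = Γ.pochInf qHalf aHalf := by
  rw [pochInf_eq hΓ, pochInf_eq hΓ, inv_inv, quotSeries, mul_assoc, ← map_mul, cycleProdInv_mul,
    map_one, mul_one]

/-! ### Integrality -/

theorem coeff_cycleProd_mem {B : (Γ.NCycle →₀ ℕ) → AddSubgroup Coeff}
    (hB : IsMulFamily Γ.xComm B)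
    (hX : ∀ C m, (X C : Γ.XSeries).coeff m ∈ B m)
    (hq : ∀ k m, ∀ c ∈ B m, 0 ≤ k → qpow (4 * k) * c ∈ B m)
    (hg : ∀ k m c, 0 < k → (1 - qpow (4 * k)) * c ∈ B m → c ∈ B m) :
    (∀ m, (cycleProd hΓ).coeff m ∈ B m) ∧ ∀ m, (cycleProdInv hΓ).coeff m ∈ B m := by
  have h := coeff_linProdInf_mem (deg_pos hΓ) hB hX hq hg
  exact ⟨h, hB.coeff_inv_mem (coeff_linProdInf_zero _) h (cycleProd_mul_inv hΓ)⟩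

theorem coeff_cycleProd_mem_wordSpan (S : Subring Coeff) (hS : Coeff.subringRMinus ≤ S) :
    (∀ m, (cycleProd hΓ).coeff m ∈ wordSpan Γ.xComm S m) ∧
      ∀ m, (cycleProdInv hΓ).coeff m ∈ wordSpan Γ.xComm S m := by
  refine coeff_cycleProd_mem hΓ isMulFamily_wordSpan (fun C m => coeff_mono_mem _ _) ?_ ?_
  · intro k m c hc hk
    refine mul_mem_wordSpan (hS (Coeff.qpow_mem_subringRMinus (by lia) ?_)) hc
    exact ⟨2 * k, by ring⟩
  · intro k m c hk hc
    obtain ⟨g, hg, h⟩ := Coeff.exists_geom hk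
    have := mul_mem_wordSpan (hS hg) hc
    rwa [← mul_assoc, mul_comm g, h, one_mul] at this

include hΓ in
theorem coeff_scale_mem_wordSpan {S : Subring Coeff} {u : Coeffˣ} (hu : (u : Coeff) ∈ S)
    {f : Γ.XSeries} (hf : ∀ m, f.coeff m ∈ wordSpan Γ.xComm S m) (m) :
    (scale Γ.deg u f).coeff m ∈ wordSpan Γ.xComm S m := by
  rw [coeff_scale]
  refine mul_mem_wordSpan ?_ (hf m)
  obtain ⟨k, hk⟩ := Int.eq_ofNat_of_zero_le (wdeg_nonneg (deg_pos hΓ) m)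
  rw [hk, zpow_natCast, Units.val_pow_eq_pow_val]
  exact pow_mem hu k

theorem coe_qHalf : (qHalf : Coeff) = qpow 2 := by
  simpa using Coeff.qHalf_zpow 1

theorem aHalf_inv_mul_qHalf_mem :
    ((aHalf⁻¹ * qHalf : Coeffˣ) : Coeff) ∈ Coeff.subringRMinus := by
  rw [Units.val_mul, coe_qHalf]
  exact mul_mem (Coeff.T_mem_subringRMinus (k := -1) (by simp))
    (Coeff.qpow_mem_subringRMinus (by simp) even_two)

theorem aHalf_mul_qHalf_mem : ((aHalf * qHalf : Coeffˣ) : Coeff) ∈ Coeff.subringR := by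
  rw [Units.val_mul, coe_qHalf]
  exact mul_mem (Coeff.T_mem_subringR 1)
    (Coeff.subringRMinus_le (Coeff.qpow_mem_subringRMinus (by simp) even_two))

include hΓ in
theorem hasCoeffsIn_pochInf :
    (Γ.pochInf qHalf aHalf).HasCoeffsIn (Coeff.subringRMinus : Set Coeff) := by
  rw [pochInf_eq hΓ, hasCoeffsIn_iff]
  exact coeff_scale_mem_wordSpan hΓ aHalf_inv_mul_qHalf_mem
    (coeff_cycleProd_mem_wordSpan hΓ _ le_rfl).1

theorem hasCoeffsIn_quotSeries : (quotSeries hΓ).HasCoeffsIn (Coeff.subringR : Set Coeff) := by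
  rw [hasCoeffsIn_iff]
  have h := coeff_cycleProd_mem_wordSpan hΓ _ Coeff.subringRMinus_le
  exact isMulFamily_wordSpan.coeff_mul_mem
    (coeff_scale_mem_wordSpan hΓ (Coeff.subringRMinus_le aHalf_inv_mul_qHalf_mem) h.1)
    (coeff_scale_mem_wordSpan hΓ aHalf_mul_qHalf_mem h.2)

/-! ### Rationality -/

theorem isMulFamily_ratSubring :
    IsMulFamily Γ.xComm
      fun _ => Coeff.ratSubring.toAddSubgroup where
  one_mem := one_mem Coeff.ratSubring
  mul_mem ha hb := mul_mem (S := Subring Coeff) (Coeff.qpow_mem_ratSubring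
    (even_reorder (fun _ _ => even_two_mul _) _ _)) (mul_mem ha hb)

theorem coeff_quotSeries_mem_ratSubring (m) : (quotSeries hΓ).coeff m ∈ Coeff.ratSubring := by
  have h := coeff_cycleProd_mem hΓ isMulFamily_ratSubring ?_ ?_ ?_
  · have hu (u : Coeffˣ) (hu : ∀ k : ℤ, ((u ^ k : Coeffˣ) : Coeff) ∈ Coeff.ratSubring)
        {f : Γ.XSeries} (hf : ∀ m, f.coeff m ∈ Coeff.ratSubring) (m) :
        (scale Γ.deg u f).coeff m ∈ Coeff.ratSubring := by
      rw [coeff_scale]; exact mul_mem (hu _) (hf m)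
    have hq (k : ℤ) : ((qHalf ^ k : Coeffˣ) : Coeff) ∈ Coeff.ratSubring := by
      rw [Coeff.qHalf_zpow]; exact Coeff.qpow_mem_ratSubring (even_two_mul k)
    refine isMulFamily_ratSubring.coeff_mul_mem (hu _ (fun k => ?_) h.1) (hu _ (fun k => ?_) h.2) m
    · have e : (aHalf⁻¹ * qHalf) ^ k = aHalf ^ (-k) * qHalf ^ k := by
        rw [zpow_neg, ← inv_zpow]; exact mul_zpow (aHalf⁻¹) _ _
      rw [e, Units.val_mul]
      exact mul_mem (Coeff.aHalf_zpow_mem_ratSubring _) (hq k)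
    · have e : (aHalf * qHalf) ^ k = aHalf ^ k * qHalf ^ k := mul_zpow aHalf _ _
      rw [e, Units.val_mul]
      exact mul_mem (Coeff.aHalf_zpow_mem_ratSubring _) (hq k)
  · intro C m
    classical
    rw [X, coeff_mono]
    split_ifs
    · exact one_mem Coeff.ratSubring
    · exact zero_mem _
  · intro k m c hc _
    exact mul_mem (S := Subring Coeff) (Coeff.qpow_mem_ratSubring ⟨2 * k, by ring⟩) hc
  · intro k m c hk hc
    exact Coeff.mem_ratSubring_of_geom hk hc

/-! ### Substitutions for `a` -/

/-- The coefficients of the infinite product do not involve `a`. -/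
theorem mapHom_cycleProd (φ : Coeff →+* Coeff) (hφ : φ qQuarterC = qQuarterC) :
    mapHom φ hφ (cycleProd hΓ) = cycleProd hΓ ∧
      mapHom φ hφ (cycleProdInv hΓ) = cycleProdInv hΓ := by
  have h := coeff_cycleProd_mem hΓ (B := fun _ => (φ.eqLocus (RingHom.id Coeff)).toAddSubgroup)
    ⟨map_one φ, fun {m n a b} ha hb => ?_⟩ ?_ ?_ ?_
  · exact ⟨QSeries.ext h.1, QSeries.ext h.2⟩
  · change φ (_ * (a * b)) = _
    rw [map_mul, map_mul, map_qpow hφ, show φ a = a from ha, show φ b = b from hb]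
    rfl
  · intro C m
    classical
    change φ _ = _
    rw [X, coeff_mono]
    split_ifs <;> simp
  · intro k m c hc _
    change φ _ = _
    rw [map_mul, map_qpow hφ, show φ c = c from hc]
    rfl
  · intro k m c hk hc
    have hc : φ ((1 - qpow (4 * k)) * c) = (1 - qpow (4 * k)) * c := hc
    rw [map_mul, map_sub, map_one, map_qpow hφ] at hc
    obtain ⟨g, -, hg⟩ := Coeff.exists_geom hk
    change φ c = c
    linear_combination g * hc - (φ c - c) * hg

theorem mapHom_quotSeries (φ : Coeff →+* Coeff) (hφ : φ qQuarterC = qQuarterC) {v : Coeffˣ}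
    (hv : φ aHalf = v) : mapHom φ hφ (quotSeries hΓ) =
      scale Γ.deg (v⁻¹ * qHalf) (cycleProd hΓ) * scale Γ.deg (v * qHalf) (cycleProdInv hΓ) := by
  have hq : φ qHalf = qHalf := by rw [coe_qHalf, map_qpow hφ]
  have hv' : φ ((aHalf⁻¹ : Coeffˣ) : Coeff) = ((v⁻¹ : Coeffˣ) : Coeff) := by
    simpa using map_zpow_of_map_eq hv (-1)
  rw [quotSeries, map_mul, mapHom_scale φ hφ _ _ (v⁻¹ * qHalf) (by simp [hv', hq]),
    mapHom_scale φ hφ _ _ (v * qHalf) (by simp [hv, hq]), (mapHom_cycleProd hΓ φ hφ).1,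
    (mapHom_cycleProd hΓ φ hφ).2]

/-- The specialization `a = q^N`, with values in the full coefficient ring. -/
def specHom (N : ℕ) : Coeff →+* Coeff := LaurentPolynomial.C.comp (specA N)

theorem specHom_qQuarterC (N : ℕ) : specHom N qQuarterC = qQuarterC := by
  change LaurentPolynomial.C (LaurentPolynomial.eval₂ _ _ (LaurentPolynomial.C _)) = _
  rw [LaurentPolynomial.eval₂_C]
  rfl

theorem specHom_aHalf (N : ℕ) : specHom N aHalf = ((qHalf ^ N : Coeffˣ) : Coeff) := by
  change LaurentPolynomial.C (LaurentPolynomial.eval₂ _ _ (LaurentPolynomial.T 1)) = _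
  rw [LaurentPolynomial.eval₂_T, zpow_one, ← zpow_natCast, ← zpow_natCast, C_coe_qQuarter_zpow,
    Coeff.qHalf_zpow]
  push_cast
  rfl

theorem mu_linSeries (u : Coeffˣ) :
    Γ.mu (scale Γ.deg u (linSeries Γ.xComm)) =
      ∑ C, ((u ^ Γ.rot C : Coeffˣ) : Coeff) • Γ.muX C := by
  have hx (C : Γ.Cycle) : Γ.mu (Γ.x C) = Γ.muX C := by
    by_cases h : C.1.Nonempty
    · rw [x, dif_pos h]
      exact Γ.isMonoMap_cycleExp.monoMap_X ⟨C, h⟩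
    · rw [x, dif_neg h, mu_eq_monoMap, ← Γ.isMonoMap_cycleExp.toRingHom_apply, map_one, muX,
        Finset.not_nonempty_iff_eq_empty.1 h]
      exact congrArg mono (map_zero Γ.hExpHom).symm
  rw [scale_linSeries, mu_eq_monoMap, ← Γ.isMonoMap_cycleExp.toRingHom_apply, map_sum]
  refine Finset.sum_congr rfl fun C _ => ?_
  rw [Γ.isMonoMap_cycleExp.toRingHom_apply, Γ.isMonoMap_cycleExp.monoMap_smul, ← mu_eq_monoMap, hx]

/-- At `a = q^N` the factors of the two infinite products cancel, except for the first `N` factors of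
the numerator; these are indexed by the elements of `A_N`. -/
theorem mapHom_mu_quotSeries (N : ℕ) :
    mapHom (specHom N) (specHom_qQuarterC N) (Γ.mu (quotSeries hΓ)) =
      ((List.range N).map fun k : ℕ => ∑ C, qpow (2 * (2 * (k : ℤ) - ((N : ℤ) - 1)) * Γ.rot C) •
        Γ.muX C).prod := by
  have hu : qHalf ^ N * qHalf = ((qHalf ^ N)⁻¹ * qHalf) * (qHalf ^ 2) ^ N := by
    group
  rw [mu_eq_monoMap, Γ.isMonoMap_cycleExp.mapHom_monoMap,
    mapHom_quotSeries hΓ _ _ (specHom_aHalf N), hu,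
    ← scale_scale _ ((qHalf ^ N)⁻¹ * qHalf), ← map_mul, cycleProd,
    ← linProd_eq_mul _ (cycleProd_mul_inv hΓ), linProd, map_list_prod,
    ← Γ.isMonoMap_cycleExp.toRingHom_apply, map_list_prod, List.map_map, List.map_map]
  congr 1
  refine List.map_congr_left fun k _ => ?_
  rw [Function.comp_apply, Function.comp_apply, scale_scale, Γ.isMonoMap_cycleExp.toRingHom_apply,
    ← mu_eq_monoMap, mu_linSeries]
  refine Finset.sum_congr rfl fun C _ => ?_
  have h : (qHalf ^ N)⁻¹ * qHalf * (qHalf ^ 2) ^ k = qHalf ^ (2 * (k : ℤ) - ((N : ℤ) - 1)) := by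
    rw [← pow_mul, ← zpow_natCast, ← zpow_natCast, ← zpow_neg, ← zpow_add_one, ← zpow_add]
    congr 1
    push_cast
    ring
  rw [h, ← zpow_mul, Coeff.qHalf_zpow, mul_assoc]

/-! ### The evaluation `⟨Γ, γ⟩` -/

theorem isHomfly_coeff (γ : Γ.Flow) :
    Γ.IsHomfly γ ((Γ.mu (quotSeries hΓ)).coeff (Γ.hExp γ.1)) := by
  refine ⟨?_, fun N _ => ?_⟩
  · exact Γ.isMonoMap_cycleExp.coeff_monoMap_mem_ratSubring
      (fun C C' => Γ.even_reorder_hExp (Γ.isFlow_ind C.1) (Γ.isFlow_ind C'.1))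
      (coeff_quotSeries_mem_ratSubring hΓ) _
  · have h := congrArg (fun s => s.coeff (Γ.hExp γ.1)) (mapHom_mu_quotSeries hΓ N)
    simp only [coeff_mapHom, coeff_prod_eq_evalN] at h
    have hC : Function.Injective (LaurentPolynomial.C (R := QLaurent)) := fun f g hfg => by
      simpa using congrArg (fun c : Coeff => c.coeff 0) hfg
    exact hC h

theorem IsHomfly.unique {γ : Γ.Flow} {h h' : Coeff} (hh : Γ.IsHomfly γ h) (hh' : Γ.IsHomfly γ h') :
    h = h' := by
  refine sub_eq_zero.1 (Coeff.eq_zero_of_specA_eq_zero fun N hN => ?_)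
  rw [map_sub, hh.2 N hN, hh'.2 N hN, sub_self]

theorem homfly_eq (γ : Γ.Flow) :
    Γ.homfly γ = (Γ.mu (quotSeries hΓ)).coeff (Γ.hExp γ.1) :=
  IsHomfly.unique (Classical.epsilon_spec (p := Γ.IsHomfly γ) ⟨_, isHomfly_coeff hΓ γ⟩)
    (isHomfly_coeff hΓ γ)

/-- The monomials that occur in the image of `μ` are the `z^γ Z^γ` with `γ` a sum of cycles, hence a flow,
so that `μ(Φ)` has no coefficients besides the `⟨Γ, γ⟩`. -/
theorem genSeries_eq : Γ.genSeries = Γ.mu (quotSeries hΓ) := by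
  ext M : 1
  change ∑ᶠ γ : Γ.Flow, Γ.homfly γ * (Γ.zZ γ.1).coeff M = _
  simp only [zZ_eq_mono]
  by_cases h : ∃ γ : Γ.Flow, Γ.hExp γ.1 = M
  · obtain ⟨γ, rfl⟩ := h
    rw [finsum_eq_single _ γ, coeff_mono_self, mul_one, homfly_eq hΓ]
    intro γ' hγ'
    rw [coeff_mono_ne fun h => hγ' (Subtype.ext (Γ.hExp_injective h.symm)), mul_zero]
  · have h0 : (Γ.mu (quotSeries hΓ)).coeff M = 0 := by
      by_contra hne
      obtain ⟨n, rfl⟩ := Γ.isMonoMap_cycleExp.exists_expMap_eq hne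
      exact h ⟨⟨_, fun v => (Γ.sum_inSlots_eq_iff _ v).2 (Γ.isFlow_sum_smul_ind n v)⟩,
        (Γ.expMap_cycleExp n).symm⟩
    rw [h0, ← finsum_zero (α := Γ.Flow)]
    refine finsum_congr fun γ => ?_
    rw [coeff_mono_ne fun h' => h ⟨γ, h'.symm⟩, mul_zero]

theorem shiftA_qQuarterC : shiftA qQuarterC = qQuarterC := by
  change LaurentPolynomial.eval₂ _ _ (LaurentPolynomial.C _) = _
  rw [LaurentPolynomial.eval₂_C]
  rfl

theorem shiftA_aHalf : shiftA aHalf = ((qHalf ^ 2 * aHalf : Coeffˣ) : Coeff) := by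
  change LaurentPolynomial.eval₂ _ _ (LaurentPolynomial.T 1) = _
  rw [LaurentPolynomial.eval₂_T, zpow_one, qHalf, ← pow_mul]

/-- The substitution `a ↦ q² a` adds a factor to the numerator of the quotient and removes one from its
denominator. -/
theorem mapHom_shiftA_quotSeries : mapHom shiftA shiftA_qQuarterC (quotSeries hΓ) =
    Γ.cyclePoly qHalf⁻¹ aHalf Γ.x * quotSeries hΓ * Γ.cyclePoly qHalf aHalf⁻¹ Γ.x := by
  have hE : cycleProd hΓ = _ * scale Γ.deg (qHalf ^ 2) (cycleProd hΓ) :=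
    linProdInf_eq (deg_pos hΓ)
  have h1 : (qHalf ^ 2 * aHalf)⁻¹ * qHalf = aHalf⁻¹ * qHalf⁻¹ := by group
  have h2 : qHalf ^ 2 * aHalf * qHalf = aHalf * qHalf * qHalf ^ 2 := by
    rw [mul_assoc]; exact mul_comm (qHalf ^ 2) _
  have h3 : aHalf⁻¹ * qHalf⁻¹ * qHalf ^ 2 = aHalf⁻¹ * qHalf := by group
  have num := congrArg (scale Γ.deg (aHalf⁻¹ * qHalf⁻¹)) hE
  rw [map_mul, scale_scale, h3] at num
  have den : scale Γ.deg (aHalf * qHalf * qHalf ^ 2) (cycleProdInv hΓ) =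
      scale Γ.deg (aHalf * qHalf) (cycleProdInv hΓ) * scale Γ.deg (aHalf * qHalf)
        (linSeries Γ.xComm) := by
    have h := congrArg (scale Γ.deg (aHalf * qHalf)) (cycleProdInv_mul hΓ)
    rw [hE, map_mul, map_mul, map_one, scale_scale, ← mul_assoc] at h
    have h' := congrArg (· * scale Γ.deg (aHalf * qHalf * qHalf ^ 2) (cycleProdInv hΓ)) h
    beta_reduce at h'
    rw [mul_assoc, ← map_mul (scale Γ.deg (aHalf * qHalf * qHalf ^ 2)), cycleProd_mul_inv, map_one,
      mul_one, one_mul] at h'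
    exact h'.symm
  rw [mapHom_quotSeries hΓ _ _ shiftA_aHalf, h1, h2, num, den, cyclePoly_eq_scale,
    cyclePoly_eq_scale, inv_inv, quotSeries]
  simp only [mul_assoc]

end MOYGraph

open MOYGraph QSeries in
theorem theorem1p3 (Γ : MOYGraph) (hΓ : Γ.Positive) :
    (∀ γ : Γ.Flow, ∃! h : Coeff, Γ.IsHomfly γ h) ∧
    Γ.genSeries.HasCoeffsIn ringR ∧
    QSeries.HasLimit (Γ.poch qHalf aHalf) (Γ.pochInf qHalf aHalf) ∧
    QSeries.HasLimit (Γ.poch qHalf aHalf⁻¹) (Γ.pochInf qHalf aHalf⁻¹) ∧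
    (Γ.pochInf qHalf aHalf).HasCoeffsIn ringRMinus ∧
    (Γ.mu (Γ.pochInf qHalf aHalf)).HasCoeffsIn ringR ∧
    Γ.genSeries * Γ.mu (Γ.pochInf qHalf aHalf⁻¹) = Γ.mu (Γ.pochInf qHalf aHalf) ∧
    Γ.genSeries.mapCoeff shiftA =
      Γ.mu (Γ.cyclePoly qHalf⁻¹ aHalf Γ.x) * Γ.genSeries *
        Γ.mu (Γ.cyclePoly qHalf aHalf⁻¹ Γ.x) := by
  have hμ := Γ.isMonoMap_cycleExp
  rw [genSeries_eq hΓ]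
  refine ⟨fun γ => ⟨_, isHomfly_coeff hΓ γ, fun h hh => hh.unique (isHomfly_coeff hΓ γ)⟩,
    hμ.hasCoeffsIn_monoMap (hasCoeffsIn_quotSeries hΓ), hasLimit_pochInf hΓ _,
    hasLimit_pochInf hΓ _, hasCoeffsIn_pochInf hΓ, ?_, ?_, ?_⟩
  · obtain ⟨c, hc, h⟩ := hasCoeffsIn_pochInf hΓ
    exact hμ.hasCoeffsIn_monoMap (S := Coeff.subringR)
      ⟨c, fun l => Coeff.subringRMinus_le (hc l), h⟩
  · have h := congrArg hμ.toRingHom (quotSeries_mul_pochInf hΓ)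
    rw [map_mul] at h
    exact h
  · have h := congrArg hμ.toRingHom (mapHom_shiftA_quotSeries hΓ)
    rw [map_mul, map_mul, hμ.toRingHom_apply, ← hμ.mapHom_monoMap] at h
    exact h

end
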